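/- Fix an integer $k\ge 1$. A rooted $k$-tree is a simple graph that is either a $k$-clique (its root-clique, whose nodes are the root nodes) or is obtained from a smaller rooted $k$-tree by adding one new non-root node $u$, joined to exactly the $k$ nodes of some $k$-clique $K$; then $u$ is called a child of $K$ and the nodes of $K$ are called the parents of $u$. The out-degree of a node $w$ is the number of non-root nodes having $w$ as a parent. An ordered increasing $k$-tree of size $n\ge 0$ is a rooted $k$-tree with root nodes $0_1,\dots,0_k$ and $n$ non-root nodes labelled $1,\dots,n$, in which the label of each non-root node is larger than the labels of all its parents (root nodes counting as $0$), together with a linear order on the set of children of each $k$-clique. Let $Y_{n,0}$ be the out-degree of the root node $0_1$ in an ordered increasing $k$-tree of size $n$ chosen uniformly at random from all of them. Write $\binom{x}{r}=\frac{x(x-1)\cdots(x-r+1)}{r!}$ for real $x$ and integers $r\ge 0$. (i) For all $n\ge 0$ and $m\ge 0$, $$\mathbb{P}\{Y_{n,0}=m\}=\frac{\binom{m-\frac{k-1}{k}}{m}}{\binom{n-\frac{k}{k+1}}{n}}\sum_{\ell=0}^{m}\binom{m}{\ell}(-1)^{\ell}\binom{n-1-\frac{k\ell}{k+1}}{n}.$$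 (ii) As $n\to\infty$, the normalized random variable $n^{-\frac{k}{k+1}}Y_{n,0}$ converges in distribution to a real random variable $Y_0$, all of whose moments exist and whose distribution is uniquely determined by its moments. For all integers $s\ge 0$, $$\mathbb{E}(Y_0^{s})=\frac{\Gamma\left(\frac{1}{k+1}\right)\Gamma\left(s+\frac{1}{k}\right)}{\Gamma\left(\frac{1}{k}\right)\Gamma\left(\frac{k}{k+1}s+\frac{1}{k+1}\right)}.$$ -/

import Mathlib

open MeasureTheory ProbabilityTheory Filter

namespace KTree

/-- The nodes of a `k`-tree of size `n`: the root nodes `0_1, …, 0_k` (left summand) and the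
non-root nodes (right summand), where `Sum.inr j` stands for the node labelled `j + 1`. -/
abbrev Node (k n : ℕ) : Type := Fin k ⊕ Fin n

/-- The label of a node; all root nodes count as `0`, the non-root nodes have labels
`1, …, n`. -/
def Node.label {k n : ℕ} : Node k n → ℕ
  | Sum.inl _ => 0
  | Sum.inr j => j.val + 1

/-- The set of root nodes together with the non-root nodes in `S`. -/
def nodesUpTo (k : ℕ) {n : ℕ} (S : Finset (Fin n)) : Finset (Node k n) :=
  Finset.univ.disjSum S

/-- `IsRootedKTree G parents S`: the subgraph of `G` induced by the root nodes and the non-root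
nodes in `S` is a rooted `k`-tree whose root-clique is formed by the root nodes, and in which the
ingoing edges of each non-root node `j ∈ S` are exactly those joining `j` to the nodes
in `parents j`. Such a tree is either the root-clique alone, or arises from a smaller one by adding
a node `j` that is joined to exactly the nodes of one `k`-clique, the parents of `j`. -/
inductive IsRootedKTree {k n : ℕ} (G : SimpleGraph (Node k n))
    (parents : Fin n → Finset (Node k n)) : Finset (Fin n) → Prop
  | root (h : G.IsNClique k (nodesUpTo k ∅)) : IsRootedKTree G parents ∅
  | attach {S : Finset (Fin n)} {j : Fin n} (hS : IsRootedKTree G parents S) (hj : j ∉ S)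
      (hsub : parents j ⊆ nodesUpTo k S) (hclique : G.IsNClique k (parents j))
      (hadj : ∀ w ∈ nodesUpTo k S, G.Adj (Sum.inr j) w ↔ w ∈ parents j) :
      IsRootedKTree G parents (insert j S)

/-- Ordered increasing `k`-trees of size `n`. -/
structure OrderedIncreasingKTree (k n : ℕ) where
  /-- The underlying simple graph. -/
  graph : SimpleGraph (Node k n)
  /-- The parents of each non-root node. -/
  parents : Fin n → Finset (Node k n)
  isRootedKTree : IsRootedKTree graph parents Finset.univ
  /-- The labelling is increasing: a node has a larger label than all of its parents. -/
  increasing : ∀ j, ∀ w ∈ parents j, w.label < Node.label (Sum.inr j : Node k n)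
  /-- The linear orders on the children of the `k`-cliques: `before i j` says that `i` and `j`
  are children of the same `k`-clique and that `i` precedes `j` among them. -/
  before : Fin n → Fin n → Prop
  before_sibling : ∀ i j, before i j → parents i = parents j
  before_irrefl : ∀ i, ¬ before i i
  before_trans : ∀ i j l, before i j → before j l → before i l
  before_total : ∀ i j, parents i = parents j → i ≠ j → before i j ∨ before j i

namespace OrderedIncreasingKTree

variable {k n : ℕ}

/-- The out-degree of a node: the number of its outgoing edges, i.e. of the non-root nodes
that have it as a parent. -/
def outDegree (T : OrderedIncreasingKTree k n) (w : Node k n) : ℕ :=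
  (Finset.univ.filter fun j => w ∈ T.parents j).card

instance : Finite (OrderedIncreasingKTree k n) := by
  refine Finite.of_injective
    (fun T : OrderedIncreasingKTree k n => (T.graph, T.parents, T.before)) ?_
  rintro ⟨g, p, _, _, b, _, _, _, _⟩ ⟨g', p', _, _, b', _, _, _, _⟩ h
  simp only [Prod.mk.injEq] at h
  obtain ⟨rfl, rfl, rfl⟩ := h
  rfl

/-- There is an ordered increasing `k`-tree of each size: attach all nodes to the root-clique. -/
instance : Nonempty (OrderedIncreasingKTree k n) := by
  let G : SimpleGraph (Node k n) :=
    { Adj := fun x y => x ≠ y ∧ (x.isLeft ∨ y.isLeft)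
      symm := ⟨fun x y h => ⟨h.1.symm, h.2.symm⟩⟩
      loopless := ⟨fun x h => h.1 rfl⟩ }
  have hroot : G.IsNClique k (nodesUpTo k (∅ : Finset (Fin n))) := by
    refine ⟨?_, by simp [nodesUpTo]⟩
    intro x hx y _ hxy
    refine ⟨hxy, Or.inl ?_⟩
    cases x <;> simp_all [nodesUpTo]
  have hsub : ∀ S : Finset (Fin n), nodesUpTo k (∅ : Finset (Fin n)) ⊆ nodesUpTo k S := by
    intro S x hx
    cases x <;> simp_all [nodesUpTo]
  have htree : ∀ S : Finset (Fin n),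
      IsRootedKTree G (fun _ => nodesUpTo k (∅ : Finset (Fin n))) S := by
    intro S
    induction S using Finset.induction_on with
    | empty => exact .root hroot
    | insert j S hj ih =>
      refine .attach ih hj (hsub S) hroot ?_
      intro w hw
      cases w <;> simp [G, nodesUpTo]
  exact ⟨⟨G, fun _ => nodesUpTo k ∅, htree _,
    by intro j w hw; cases w <;> simp_all [nodesUpTo, Node.label],
    fun i j => i < j, fun _ _ _ => rfl, fun i => lt_irrefl i, fun _ _ _ => lt_trans,
    fun _ _ _ h => lt_or_gt_of_ne h⟩⟩

instance : MeasurableSpace (OrderedIncreasingKTree k n) := ⊤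

instance : DiscreteMeasurableSpace (OrderedIncreasingKTree k n) := ⟨fun _ => trivial⟩

end OrderedIncreasingKTree

/-- The random ordered increasing `k`-tree model: the uniform distribution on the ordered
increasing `k`-trees of size `n`. -/
noncomputable def randomKTree (k n : ℕ) : Measure (OrderedIncreasingKTree k n) :=
  uniformOn Set.univ

instance (k n : ℕ) : IsProbabilityMeasure (randomKTree k n) :=
  inferInstanceAs (IsProbabilityMeasure (uniformOn Set.univ))

/-- The random variable `Y_{n,0}`: the out-degree of the root node `0_1` in a `k`-tree
of size `n`. -/
def rootOutDegree {k : ℕ} (hk : 1 ≤ k) (n : ℕ) (T : OrderedIncreasingKTree k n) : ℕ :=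
  T.outDegree (Sum.inl ⟨0, hk⟩)

end KTree

/-!
A tree of size `n + 1` arises exactly once from a tree of size `n` by attaching the node with the
largest label, either as the first child of one of the `k`-cliques or as the immediate successor of
one of the `n` non-root nodes `j` among the children of the parents of `j`
(`KTree.OrderedIncreasingKTree.attachEquiv`). The tree has `1 + k n` `k`-cliques, and `1 + (k - 1) d`
of them contain the root node `0_1` when this has out-degree `d`; together with its `d` children
this gives `1 + k d` out of `(k + 1) n + 1` places at which the out-degree grows. So the
out-degree is a Markov chain with an explicit generator (`KTree.meanRootOutDegree_succ`).

The formula for the distribution satisfies the same recursion, term by term in the alternating sum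
(`KTree.alternatingSum_succ`, `KTree.meanRootOutDegree_single`).

For the limit, the rising factorials of `Y_{n,0} + 1 / k` are eigenfunctions of the step of the
chain, so that their expectations are explicit products, whose growth is given by Euler's product
for the Gamma function (`KTree.tendsto_mean_ascPochhammer`). Powers differ from rising factorials in
lower order only, so all moments of the normalized out-degree converge. The limits grow slowly
enough for the Taylor series of the characteristic function to converge everywhere, so they
determine a distribution (`ext_of_moments`), and the method of moments applies, with Prokhorov's
theorem providing the limit (`exists_tendsto_of_moments`).
-/

namespace KTree

variable {k n : ℕ}

/-! ### Increasing `k`-trees are determined by their parent sets -/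

/-- The graph on the nodes in which the root nodes form a clique and every non-root node `j` is
joined to the nodes of `p j`. -/
def graphOfParents (p : Fin n → Finset (Node k n)) : SimpleGraph (Node k n) where
  Adj x y := x ≠ y ∧ ((x.isLeft ∧ y.isLeft) ∨ (∃ j, x = Sum.inr j ∧ y ∈ p j) ∨
    ∃ j, y = Sum.inr j ∧ x ∈ p j)
  symm := ⟨fun _ _ h => ⟨h.1.symm, h.2.imp And.symm Or.symm⟩⟩
  loopless := ⟨fun _ h => h.1 rfl⟩

/-- The property that every node has a larger label than its parents. -/
def IncreasingParents (p : Fin n → Finset (Node k n)) : Prop :=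
  ∀ j, ∀ w ∈ p j, w.label < Node.label (Sum.inr j : Node k n)

lemma inr_mem_nodesUpTo {S : Finset (Fin n)} {j : Fin n} :
    (Sum.inr j : Node k n) ∈ nodesUpTo k S ↔ j ∈ S := by
  simp [nodesUpTo]

lemma inl_mem_nodesUpTo {S : Finset (Fin n)} {a : Fin k} :
    (Sum.inl a : Node k n) ∈ nodesUpTo k S := by
  simp [nodesUpTo]

lemma IncreasingParents.lt {p : Fin n → Finset (Node k n)} (h : IncreasingParents p)
    {i j : Fin n} (hij : Sum.inr i ∈ p j) : i < j := by
  have := h j _ hij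
  simp only [Node.label] at this
  exact Fin.lt_def.2 (by omega)

lemma IsRootedKTree.root_clique {G : SimpleGraph (Node k n)} {p : Fin n → Finset (Node k n)}
    {S : Finset (Fin n)} (h : IsRootedKTree G p S) : G.IsNClique k (nodesUpTo k ∅) := by
  induction h with
  | root h => exact h
  | attach _ _ _ _ _ ih => exact ih

lemma IsRootedKTree.parents_clique {G : SimpleGraph (Node k n)} {p : Fin n → Finset (Node k n)}
    {S : Finset (Fin n)} (h : IsRootedKTree G p S) : ∀ j ∈ S, G.IsNClique k (p j) := by
  induction h with
  | root h => simp
  | attach _ _ _ hc _ ih =>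
    intro i hi
    rcases Finset.mem_insert.1 hi with rfl | hi
    exacts [hc, ih _ hi]

lemma IsRootedKTree.parents_subset {G : SimpleGraph (Node k n)} {p : Fin n → Finset (Node k n)}
    {S : Finset (Fin n)} (h : IsRootedKTree G p S) : ∀ j ∈ S, p j ⊆ nodesUpTo k S := by
  have mono : ∀ {S T : Finset (Fin n)}, S ⊆ T → nodesUpTo k S ⊆ nodesUpTo k T := by
    intro S T hST x hx
    cases x with
    | inl a => exact inl_mem_nodesUpTo
    | inr i => exact inr_mem_nodesUpTo.2 (hST (inr_mem_nodesUpTo.1 hx))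
  induction h with
  | root h => simp
  | attach _ _ hs _ _ ih =>
    intro i hi
    rcases Finset.mem_insert.1 hi with rfl | hi
    exacts [hs.trans (mono (Finset.subset_insert _ _)),
      (ih _ hi).trans (mono (Finset.subset_insert _ _))]

/-- Whatever the order in which the nodes are attached, in an increasing tree the neighbours of a
node with smaller label are its parents. -/
lemma IsRootedKTree.adj_iff {G : SimpleGraph (Node k n)} {p : Fin n → Finset (Node k n)}
    {S : Finset (Fin n)} (h : IsRootedKTree G p S) (hp : IncreasingParents p) :
    ∀ j ∈ S, ∀ w ∈ nodesUpTo k S, w.label < Node.label (Sum.inr j : Node k n) →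
      (G.Adj (Sum.inr j) w ↔ w ∈ p j) := by
  induction h with
  | root h => simp
  | @attach S j hS hj hs hc ha ih =>
    intro i hi w hw hlt
    rcases Finset.mem_insert.1 hi with rfl | hiS
    · cases w with
      | inl a => exact ha _ inl_mem_nodesUpTo
      | inr l =>
        rcases Finset.mem_insert.1 (inr_mem_nodesUpTo.1 hw) with rfl | hl
        · exact absurd hlt (lt_irrefl _)
        · exact ha _ (inr_mem_nodesUpTo.2 hl)
    · cases w with
      | inl a => exact ih i hiS _ inl_mem_nodesUpTo hlt
      | inr l =>
        rcases Finset.mem_insert.1 (inr_mem_nodesUpTo.1 hw) with rfl | hl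
        · -- here `l` is attached after `i` although its label is smaller
          have h1 : ¬ G.Adj (Sum.inr i) (Sum.inr l) := by
            rw [G.adj_comm, ha _ (inr_mem_nodesUpTo.2 hiS)]
            intro h
            exact absurd (hp _ _ h) (not_lt.2 hlt.le)
          have h2 : Sum.inr l ∉ p i := fun h =>
            hj (inr_mem_nodesUpTo.1 (hS.parents_subset i hiS h))
          simp [h1, h2]
        · exact ih i hiS _ (inr_mem_nodesUpTo.2 hl) hlt

lemma isRootedKTree_graphOfParents {p : Fin n → Finset (Node k n)} (hp : IncreasingParents p)
    (hc : ∀ j, (graphOfParents p).IsNClique k (p j)) :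
    IsRootedKTree (graphOfParents p) p Finset.univ := by
  have key : ∀ m, m ≤ n → IsRootedKTree (graphOfParents p) p
      (Finset.univ.filter fun j : Fin n => j.val < m) := by
    intro m
    induction m with
    | zero =>
      intro _
      have : (Finset.univ.filter fun j : Fin n => j.val < 0) = ∅ := by simp
      rw [this]
      refine .root ⟨?_, by simp [nodesUpTo]⟩
      intro x hx y hy hxy
      refine ⟨hxy, Or.inl ?_⟩
      cases x <;> cases y <;> simp_all [nodesUpTo]
    | succ m ih =>
      intro hm
      have hS := ih (by omega)
      have : (Finset.univ.filter fun j : Fin n => j.val < m + 1) =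
          insert ⟨m, hm⟩ (Finset.univ.filter fun j : Fin n => j.val < m) := by
        ext j
        simp only [Finset.mem_filter, Finset.mem_univ, true_and, Finset.mem_insert, Fin.ext_iff]
        omega
      rw [this]
      refine .attach hS (by simp) ?_ (hc _) ?_
      · intro w hw
        cases w with
        | inl a => exact inl_mem_nodesUpTo
        | inr l => exact inr_mem_nodesUpTo.2 (by simpa using Fin.lt_def.1 (hp.lt hw))
      · intro w hw
        constructor
        · rintro ⟨_, h | ⟨j, hj, h⟩ | ⟨j, rfl, h⟩⟩
          · simp at h
          · obtain rfl := Sum.inr_injective hj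
            exact h
          · have h1 := Fin.lt_def.1 (hp.lt h)
            have h2 := inr_mem_nodesUpTo.1 hw
            simp only [Finset.mem_filter, Finset.mem_univ, true_and] at h2 h1
            omega
        · intro h
          refine ⟨?_, Or.inr (Or.inl ⟨_, rfl, h⟩)⟩
          rintro rfl
          exact lt_irrefl _ (hp.lt h)
  have h := key n le_rfl
  have : (Finset.univ.filter fun j : Fin n => j.val < n) = Finset.univ := by ext; simp
  rwa [this] at h

namespace OrderedIncreasingKTree

lemma graph_eq (T : OrderedIncreasingKTree k n) : T.graph = graphOfParents T.parents := by
  have hmem : ∀ w : Node k n, w ∈ nodesUpTo k (Finset.univ : Finset (Fin n)) := by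
    intro w
    cases w <;> simp [nodesUpTo]
  have hadj : ∀ (j : Fin n) (w : Node k n), w.label < Node.label (Sum.inr j : Node k n) →
      (T.graph.Adj (Sum.inr j) w ↔ w ∈ T.parents j) := fun j w h =>
    T.isRootedKTree.adj_iff T.increasing j (Finset.mem_univ _) w (hmem w) h
  have hinc : IncreasingParents T.parents := T.increasing
  ext x y
  rcases x with a | i <;> rcases y with b | j
  · have := T.isRootedKTree.root_clique.1
    constructor
    · intro h
      exact ⟨h.ne, Or.inl ⟨rfl, rfl⟩⟩
    · intro h
      exact this (by simp [nodesUpTo]) (by simp [nodesUpTo]) h.1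
  · rw [T.graph.adj_comm, hadj j _ (by simp [Node.label])]
    simp [graphOfParents]
  · rw [hadj i _ (by simp [Node.label])]
    simp [graphOfParents]
  · rcases lt_trichotomy i j with h | rfl | h
    · have h1 : Sum.inr j ∉ T.parents i := fun h' => absurd (hinc.lt h') h.asymm
      rw [T.graph.adj_comm, hadj j _ (by simpa [Node.label] using h)]
      simp [graphOfParents, h1, h.ne]
    · simp
    · have h1 : Sum.inr i ∉ T.parents j := fun h' => absurd (hinc.lt h') h.asymm
      rw [hadj i _ (by simpa [Node.label] using h)]
      simp [graphOfParents, h1, h.ne']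

lemma isNClique_parents (T : OrderedIncreasingKTree k n) (j : Fin n) :
    T.graph.IsNClique k (T.parents j) :=
  T.isRootedKTree.parents_clique j (Finset.mem_univ _)

lemma ext_parents_before {T T' : OrderedIncreasingKTree k n} (hp : T.parents = T'.parents)
    (hb : T.before = T'.before) : T = T' := by
  have hg : T.graph = T'.graph := by rw [graph_eq, graph_eq, hp]
  cases T
  cases T'
  simp only at hp hb hg
  subst hp hb hg
  rfl

end OrderedIncreasingKTree

/-! ### Attaching the node with the largest label -/

/-- The inclusion of the nodes of a tree of size `n` into those of a tree of size `n + 1`. -/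
def liftNode : Node k n ↪ Node k (n + 1) :=
  (Function.Embedding.refl _).sumMap Fin.castSuccEmb

@[simp] lemma liftNode_inl (a : Fin k) : (liftNode (Sum.inl a) : Node k (n + 1)) = Sum.inl a := rfl

@[simp] lemma liftNode_inr (j : Fin n) :
    (liftNode (Sum.inr j) : Node k (n + 1)) = Sum.inr j.castSucc := rfl

@[simp] lemma label_liftNode (w : Node k n) : (liftNode w).label = w.label := by
  cases w <;> rfl

lemma label_le (w : Node k n) : w.label ≤ n := by
  cases w with
  | inl a => simp [Node.label]
  | inr j => simp only [Node.label]; omega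

lemma liftNode_ne_last (w : Node k n) : liftNode w ≠ Sum.inr (Fin.last n) := by
  cases w with
  | inl a => simp
  | inr j => simp

lemma last_notMem_map (s : Finset (Node k n)) : Sum.inr (Fin.last n) ∉ s.map liftNode := by
  simp only [Finset.mem_map, not_exists, not_and]
  exact fun w _ => liftNode_ne_last w

lemma node_cases (w : Node k (n + 1)) : w = Sum.inr (Fin.last n) ∨ ∃ v, w = liftNode v := by
  rcases w with a | j
  · exact Or.inr ⟨Sum.inl a, rfl⟩
  · induction j using Fin.lastCases with
    | last => exact Or.inl rfl
    | cast j => exact Or.inr ⟨Sum.inr j, rfl⟩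

lemma exists_eq_map {s : Finset (Node k (n + 1))} (h : Sum.inr (Fin.last n) ∉ s) :
    ∃ t : Finset (Node k n), s = t.map liftNode := by
  refine ⟨Finset.univ.filter fun w => liftNode w ∈ s, ?_⟩
  ext w
  rcases node_cases w with rfl | ⟨v, rfl⟩
  · simp only [h, false_iff]
    exact last_notMem_map _
  · rw [Finset.mem_map']
    simp

/-- The parent sets of the tree of size `n + 1` whose last node has parent set `K`. -/
def snocParents (p : Fin n → Finset (Node k n)) (K : Finset (Node k n)) :
    Fin (n + 1) → Finset (Node k (n + 1)) :=
  Fin.lastCases (K.map liftNode) fun j => (p j).map liftNode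

@[simp] lemma snocParents_last (p : Fin n → Finset (Node k n)) (K : Finset (Node k n)) :
    snocParents p K (Fin.last n) = K.map liftNode := by
  simp [snocParents]

@[simp] lemma snocParents_castSucc (p : Fin n → Finset (Node k n)) (K : Finset (Node k n))
    (j : Fin n) : snocParents p K j.castSucc = (p j).map liftNode := by
  simp [snocParents]

lemma snocParents_injective {p p' : Fin n → Finset (Node k n)} {K K' : Finset (Node k n)}
    (h : snocParents p K = snocParents p' K') : p = p' ∧ K = K' := by
  constructor
  · funext j
    have := congrFun h j.castSucc
    simpa using this
  · have := congrFun h (Fin.last n)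
    simpa using this

lemma IncreasingParents.exists_snoc {p : Fin (n + 1) → Finset (Node k (n + 1))}
    (hp : IncreasingParents p) : ∃ q K, p = snocParents q K := by
  have h : ∀ j, ∃ t : Finset (Node k n), p j = t.map liftNode := fun j =>
    exists_eq_map fun h => absurd (hp.lt h) (not_lt.2 (Fin.le_last j))
  choose q hq using h
  refine ⟨fun j => q j.castSucc, q (Fin.last n), ?_⟩
  funext j
  induction j using Fin.lastCases with
  | last => simp [hq]
  | cast j => simp [hq]

lemma increasingParents_snoc {p : Fin n → Finset (Node k n)} {K : Finset (Node k n)} :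
    IncreasingParents (snocParents p K) ↔ IncreasingParents p := by
  constructor
  · intro h j w hw
    have := h j.castSucc (liftNode w) (by simpa using hw)
    rwa [← liftNode_inr, label_liftNode, label_liftNode] at this
  · intro h j w hw
    induction j using Fin.lastCases with
    | last =>
      simp only [snocParents_last, Finset.mem_map] at hw
      obtain ⟨v, _, rfl⟩ := hw
      rw [label_liftNode]
      refine (label_le v).trans_lt ?_
      simp [Node.label]
    | cast j =>
      simp only [snocParents_castSucc, Finset.mem_map] at hw
      obtain ⟨v, hv, rfl⟩ := hw
      rw [← liftNode_inr, label_liftNode, label_liftNode]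
      exact h j v hv

lemma graphOfParents_snoc_adj_liftNode (p : Fin n → Finset (Node k n)) (K : Finset (Node k n))
    (x y : Node k n) :
    (graphOfParents (snocParents p K)).Adj (liftNode x) (liftNode y) ↔
      (graphOfParents p).Adj x y := by
  have hL : ∀ z : Node k n, (liftNode z).isLeft = z.isLeft := by rintro (a | j) <;> rfl
  have hE : ∀ x y : Node k n, (∃ j, liftNode x = Sum.inr j ∧ liftNode y ∈ snocParents p K j) ↔
      ∃ j, x = Sum.inr j ∧ y ∈ p j := by
    intro x y
    constructor
    · rintro ⟨j, h1, h2⟩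
      induction j using Fin.lastCases with
      | last => exact absurd h1 (liftNode_ne_last x)
      | cast j =>
        rw [← liftNode_inr] at h1
        rw [snocParents_castSucc, Finset.mem_map'] at h2
        exact ⟨j, liftNode.injective h1, h2⟩
    · rintro ⟨j, rfl, h⟩
      exact ⟨j.castSucc, rfl, by simpa using h⟩
  simp only [graphOfParents, hL, hE, liftNode.injective.ne_iff]

lemma graphOfParents_snoc_adj_last (p : Fin n → Finset (Node k n)) (K : Finset (Node k n))
    (x : Node k n) :
    (graphOfParents (snocParents p K)).Adj (Sum.inr (Fin.last n)) (liftNode x) ↔ x ∈ K := by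
  constructor
  · rintro ⟨_, h | ⟨j, h1, h2⟩ | ⟨j, h1, h2⟩⟩
    · simp at h
    · obtain rfl := Sum.inr_injective h1
      simpa using h2
    · induction j using Fin.lastCases with
      | last => exact absurd h1 (liftNode_ne_last x)
      | cast j =>
        rw [snocParents_castSucc] at h2
        exact absurd h2 (last_notMem_map _)
  · intro h
    exact ⟨(liftNode_ne_last x).symm, Or.inr (Or.inl ⟨_, rfl, by simpa using h⟩)⟩

lemma isNClique_map_snoc {p : Fin n → Finset (Node k n)} {K C : Finset (Node k n)} :
    (graphOfParents (snocParents p K)).IsNClique k (C.map liftNode) ↔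
      (graphOfParents p).IsNClique k C := by
  rw [SimpleGraph.isNClique_iff, SimpleGraph.isNClique_iff, Finset.card_map]
  refine and_congr_left fun _ => ?_
  rw [Finset.coe_map, SimpleGraph.isClique_iff, SimpleGraph.isClique_iff,
    liftNode.injective.injOn.pairwise_image]
  simp only [Set.Pairwise, Function.onFun, graphOfParents_snoc_adj_liftNode]

namespace OrderedIncreasingKTree

/-- Attach the node with label `n + 1` to the `k`-clique `K`, where `L` is the set of the children
of `K` that precede the new node. -/
def attach (T : OrderedIncreasingKTree k n) (K : Finset (Node k n)) (L : Fin n → Prop)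
    (hK : T.graph.IsNClique k K) (hL : ∀ i, L i → T.parents i = K)
    (hlow : ∀ i j, T.before i j → L j → L i) : OrderedIncreasingKTree k (n + 1) where
  graph := graphOfParents (snocParents T.parents K)
  parents := snocParents T.parents K
  isRootedKTree := by
    refine isRootedKTree_graphOfParents (increasingParents_snoc.2 T.increasing) fun j => ?_
    induction j using Fin.lastCases with
    | last => rwa [snocParents_last, isNClique_map_snoc, ← T.graph_eq]
    | cast j =>
      rw [snocParents_castSucc, isNClique_map_snoc, ← T.graph_eq]
      exact T.isNClique_parents j
  increasing := increasingParents_snoc.2 T.increasing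
  before := Fin.lastCases (Fin.lastCases False fun j => T.parents j = K ∧ ¬ L j)
    fun i => Fin.lastCases (L i) fun j => T.before i j
  before_sibling i j := by
    induction i using Fin.lastCases <;> induction j using Fin.lastCases
    · simp
    · simp only [Fin.lastCases_last, Fin.lastCases_castSucc, snocParents_last,
        snocParents_castSucc]
      rintro ⟨h, _⟩
      rw [h]
    · simp only [Fin.lastCases_last, Fin.lastCases_castSucc, snocParents_last,
        snocParents_castSucc]
      intro h
      rw [hL _ h]
    · simp only [Fin.lastCases_castSucc, snocParents_castSucc]
      intro h
      rw [T.before_sibling _ _ h]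
  before_irrefl i := by
    induction i using Fin.lastCases
    · simp
    · simpa using T.before_irrefl _
  before_trans i j l := by
    have tr := T.before_trans
    have tt := T.before_total
    have ts := T.before_sibling
    induction i using Fin.lastCases <;> induction j using Fin.lastCases <;>
      induction l using Fin.lastCases <;>
      simp only [Fin.lastCases_last, Fin.lastCases_castSucc] <;> grind
  before_total i j := by
    have tt := T.before_total
    induction i using Fin.lastCases <;> induction j using Fin.lastCases <;>
      simp only [Fin.lastCases_last, Fin.lastCases_castSucc, snocParents_last,
        snocParents_castSucc, Finset.map_inj, (Fin.castSucc_injective n).ne_iff] <;> grind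

/-- The `k`-cliques of a tree. -/
noncomputable def cliques (T : OrderedIncreasingKTree k n) : Finset (Finset (Node k n)) := by
  classical exact Finset.univ.filter fun C => T.graph.IsNClique k C

lemma mem_cliques {T : OrderedIncreasingKTree k n} {C : Finset (Node k n)} :
    C ∈ T.cliques ↔ T.graph.IsNClique k C := by
  simp [cliques]

/-- The places at which a new node can be attached: as the first child of a `k`-clique, or as the
immediate successor of a non-root node among the children of the parents of that node. -/
abbrev Place (T : OrderedIncreasingKTree k n) : Type := T.cliques ⊕ Fin n

/-- The `k`-clique to which a node attached at the given place is joined. -/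
def Place.clique {T : OrderedIncreasingKTree k n} : T.Place → Finset (Node k n)
  | Sum.inl C => C
  | Sum.inr j => T.parents j

/-- The children of the clique that precede a node attached at the given place. -/
def Place.pred {T : OrderedIncreasingKTree k n} : T.Place → Fin n → Prop
  | Sum.inl _, _ => False
  | Sum.inr j, i => i = j ∨ T.before i j

/-- Attach the node with label `n + 1` at a given place. -/
def attachAt (T : OrderedIncreasingKTree k n) (x : T.Place) : OrderedIncreasingKTree k (n + 1) :=
  T.attach x.clique x.pred
    (by
      rcases x with C | j
      exacts [mem_cliques.1 C.2, T.isNClique_parents j])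
    (by
      rcases x with C | j
      · exact fun _ h => h.elim
      · rintro i (rfl | h)
        exacts [rfl, T.before_sibling _ _ h])
    (by
      rcases x with C | j
      · exact fun _ _ _ h => h
      · rintro i l h (rfl | h')
        exacts [Or.inr h, Or.inr (T.before_trans _ _ _ h h')])

lemma attachAt_injective {T T' : OrderedIncreasingKTree k n} {x : T.Place} {x' : T'.Place}
    (h : T.attachAt x = T'.attachAt x') : (⟨T, x⟩ : Σ T : OrderedIncreasingKTree k n, T.Place) =
      ⟨T', x'⟩ := by
  have hp : snocParents T.parents x.clique = snocParents T'.parents x'.clique :=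
    congrArg OrderedIncreasingKTree.parents h
  obtain ⟨hp, hK⟩ := snocParents_injective hp
  have hb := congrArg OrderedIncreasingKTree.before h
  have hT : T = T' := by
    refine ext_parents_before hp ?_
    funext i j
    simpa [attachAt, attach] using congrFun (congrFun hb i.castSucc) j.castSucc
  subst hT
  have hL : ∀ i, x.pred i = x'.pred i := fun i => by
    simpa [attachAt, attach] using congrFun (congrFun hb i.castSucc) (Fin.last n)
  congr 1
  rcases x with C | j <;> rcases x' with C' | j'
  · exact congrArg Sum.inl (Subtype.ext hK)
  · exact absurd (hL j') (by simp [Place.pred])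
  · exact absurd (hL j) (by simp [Place.pred])
  · have h1 : j = j' ∨ T.before j j' := by
      have := hL j
      simpa [Place.pred] using this
    have h2 : j' = j ∨ T.before j' j := by
      have := hL j'
      simpa [Place.pred] using this
    rcases h1 with rfl | h1
    · rfl
    · rcases h2 with rfl | h2
      · rfl
      · exact absurd (T.before_trans _ _ _ h1 h2) (T.before_irrefl _)

lemma exists_attachAt (T' : OrderedIncreasingKTree k (n + 1)) :
    ∃ (T : OrderedIncreasingKTree k n) (x : T.Place), T.attachAt x = T' := by
  obtain ⟨p, K, hpK⟩ := IncreasingParents.exists_snoc T'.increasing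
  have hinc : IncreasingParents p := increasingParents_snoc.1 (hpK ▸ T'.increasing)
  have hG := T'.graph_eq
  rw [hpK] at hG
  have hcl : ∀ j, (graphOfParents p).IsNClique k (p j) := fun j => by
    have := T'.isNClique_parents j.castSucc
    rwa [hG, hpK, snocParents_castSucc, isNClique_map_snoc] at this
  have hK : (graphOfParents p).IsNClique k K := by
    have := T'.isNClique_parents (Fin.last n)
    rwa [hG, hpK, snocParents_last, isNClique_map_snoc] at this
  have hsib : ∀ i j, T'.before i j → snocParents p K i = snocParents p K j := fun i j h => by
    simpa [hpK] using T'.before_sibling i j h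
  have htot : ∀ i j, snocParents p K i = snocParents p K j → i ≠ j →
      T'.before i j ∨ T'.before j i := fun i j h => T'.before_total i j (by rwa [hpK])
  let T : OrderedIncreasingKTree k n :=
    { graph := graphOfParents p
      parents := p
      isRootedKTree := isRootedKTree_graphOfParents hinc hcl
      increasing := hinc
      before := fun i j => T'.before i.castSucc j.castSucc
      before_sibling := fun i j h => by simpa using hsib _ _ h
      before_irrefl := fun i => T'.before_irrefl _
      before_trans := fun i j l => T'.before_trans _ _ _
      before_total := fun i j h hij =>
        htot _ _ (by simpa using h) ((Fin.castSucc_injective n).ne hij) }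
  have hLK : ∀ i, T'.before (Fin.castSucc i) (Fin.last n) → p i = K := fun i h => by
    simpa using hsib _ _ h
  have hlast : ∀ j, (T.parents j = K ∧ ¬ T'.before (Fin.castSucc j) (Fin.last n)) =
      T'.before (Fin.last n) (Fin.castSucc j) := fun j => by
    refine propext ⟨fun h => ?_, fun h => ⟨?_, fun h' => ?_⟩⟩
    · refine (htot (Fin.last n) j.castSucc ?_ (Fin.castSucc_ne_last j).symm).resolve_right h.2
      rw [snocParents_last, snocParents_castSucc]
      exact congrArg _ h.1.symm
    · exact (by simpa using hsib _ _ h : K = p j).symm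
    · exact T'.before_irrefl _ (T'.before_trans _ _ _ h h')
  -- it suffices to find a place whose clique and predecessors are those of the last node
  have key : ∀ x : T.Place, x.clique = K →
      (∀ i, x.pred i ↔ T'.before (Fin.castSucc i) (Fin.last n)) → T.attachAt x = T' := by
    intro x hx hxL
    refine ext_parents_before ?_ ?_
    · rw [hpK]
      simp only [attachAt, attach, hx]
      rfl
    · funext i j
      induction i using Fin.lastCases <;> induction j using Fin.lastCases
      · simpa [attachAt, attach] using T'.before_irrefl _
      · simpa only [attachAt, attach, Fin.lastCases_last, Fin.lastCases_castSucc, hx, hxL]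
          using hlast _
      · simpa only [attachAt, attach, Fin.lastCases_last, Fin.lastCases_castSucc] using
          propext (hxL _)
      · simp only [attachAt, attach, Fin.lastCases_castSucc]
        rfl
  by_cases hne : ∃ i : Fin n, T'.before i.castSucc (Fin.last n)
  · -- the last of the predecessors
    have : Std.Irrefl (flip T.before) := ⟨T.before_irrefl⟩
    have : IsTrans (Fin n) (flip T.before) := ⟨fun i j l h h' => T.before_trans _ _ _ h' h⟩
    obtain ⟨j, hj, hmax⟩ := (Finite.wellFounded_of_trans_of_irrefl (flip T.before)).has_min
      {i : Fin n | T'.before i.castSucc (Fin.last n)} hne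
    refine ⟨T, Sum.inr j, key _ (hLK j hj) fun i => ⟨?_, fun hi => ?_⟩⟩
    · rintro (rfl | h)
      exacts [hj, T'.before_trans _ _ _ h hj]
    · by_cases hij : i = j
      · exact Or.inl hij
      · exact Or.inr ((T.before_total i j ((hLK i hi).trans (hLK j hj).symm) hij).resolve_right
          (hmax i hi))
  · refine ⟨T, Sum.inl ⟨K, mem_cliques.2 hK⟩, key _ rfl fun i => ⟨fun h => h.elim, fun h => ?_⟩⟩
    exact hne ⟨i, h⟩

/-- Every tree of size `n + 1` arises exactly once by attaching a node to a tree of size `n`. -/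
noncomputable def attachEquiv (k n : ℕ) :
    (Σ T : OrderedIncreasingKTree k n, T.Place) ≃ OrderedIncreasingKTree k (n + 1) :=
  Equiv.ofBijective (fun x => x.1.attachAt x.2)
    ⟨fun _ _ h => attachAt_injective h, fun T' => by
      obtain ⟨T, x, h⟩ := T'.exists_attachAt
      exact ⟨⟨T, x⟩, h⟩⟩

end OrderedIncreasingKTree

end KTree

namespace KTree

namespace OrderedIncreasingKTree

variable {k n : ℕ}

/-! ### Counting cliques and places -/

/-- Besides the old `k`-cliques, the tree has the `k`-cliques that contain the new node and all but one of
its parents. -/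
lemma mem_cliques_attachAt {T : OrderedIncreasingKTree k n} {x : T.Place}
    {D : Finset (Node k (n + 1))} :
    D ∈ (T.attachAt x).cliques ↔ (∃ C ∈ T.cliques, C.map liftNode = D) ∨
      ∃ y ∈ x.clique, insert (Sum.inr (Fin.last n)) ((x.clique.erase y).map liftNode) = D := by
  have hK : (graphOfParents T.parents).IsNClique k x.clique := by
    rw [← T.graph_eq]
    rcases x with C | j
    exacts [mem_cliques.1 C.2, T.isNClique_parents j]
  have hg : (T.attachAt x).graph = graphOfParents (snocParents T.parents x.clique) := rfl
  rw [mem_cliques, hg]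
  simp only [mem_cliques, T.graph_eq]
  constructor
  · intro hD
    by_cases hl : Sum.inr (Fin.last n) ∈ D
    · right
      obtain ⟨E, hE⟩ := exists_eq_map (Finset.notMem_erase (Sum.inr (Fin.last n)) D)
      have hEK : E ⊆ x.clique := by
        intro w hw
        have hw' : liftNode w ∈ D.erase (Sum.inr (Fin.last n)) := by
          rw [hE]
          exact Finset.mem_map_of_mem _ hw
        rw [← graphOfParents_snoc_adj_last T.parents]
        exact hD.1 hl (Finset.mem_of_mem_erase hw') (Finset.ne_of_mem_erase hw').symm
      have hcard : E.card + 1 = k := by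
        rw [← Finset.card_map liftNode, ← hE, Finset.card_erase_add_one hl, hD.2]
      have h1 : (x.clique \ E).card = 1 := by
        rw [Finset.card_sdiff_of_subset hEK, hK.2]
        omega
      obtain ⟨y, hy⟩ := Finset.card_eq_one.1 h1
      have hyK : y ∈ x.clique \ E := by simp [hy]
      refine ⟨y, (Finset.mem_sdiff.1 hyK).1, ?_⟩
      rw [Finset.erase_eq, ← hy, Finset.sdiff_sdiff_eq_self hEK, ← hE, Finset.insert_erase hl]
    · left
      obtain ⟨C, rfl⟩ := exists_eq_map hl
      exact ⟨C, isNClique_map_snoc.1 hD, rfl⟩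
  · rintro (⟨C, hC, rfl⟩ | ⟨y, hy, rfl⟩)
    · exact isNClique_map_snoc.2 hC
    · have hk : 1 ≤ k := by
        rw [← hK.2]
        exact Finset.card_pos.2 ⟨y, hy⟩
      have h1 : (graphOfParents (snocParents T.parents x.clique)).IsNClique (k - 1)
          ((x.clique.erase y).map liftNode) := by
        refine ⟨?_, by rw [Finset.card_map, Finset.card_erase_of_mem hy, hK.2]⟩
        refine (isNClique_map_snoc.2 hK).1.subset ?_
        exact_mod_cast Finset.map_subset_map.2 (Finset.erase_subset _ _)
      have h2 := h1.insert (a := Sum.inr (Fin.last n)) (by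
        intro b hb
        obtain ⟨w, hw, rfl⟩ := Finset.mem_map.1 hb
        rw [graphOfParents_snoc_adj_last]
        exact Finset.mem_of_mem_erase hw)
      rwa [Nat.sub_add_cancel hk] at h2

lemma card_place_clique {T : OrderedIncreasingKTree k n} (x : T.Place) : x.clique.card = k := by
  rcases x with C | j
  exacts [(mem_cliques.1 C.2).2, (T.isNClique_parents j).2]

lemma card_filter_cliques_attachAt (T : OrderedIncreasingKTree k n) (x : T.Place)
    (P : Finset (Node k (n + 1)) → Prop) [DecidablePred P] :
    ((T.attachAt x).cliques.filter P).card =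
      (T.cliques.filter fun C => P (C.map liftNode)).card +
      (x.clique.filter fun y =>
        P (insert (Sum.inr (Fin.last n)) ((x.clique.erase y).map liftNode))).card := by
  have hc : (T.attachAt x).cliques = T.cliques.image (fun C => C.map liftNode) ∪
      x.clique.image
        (fun y => insert (Sum.inr (Fin.last n)) ((x.clique.erase y).map liftNode)) := by
    ext D
    rw [mem_cliques_attachAt, Finset.mem_union, Finset.mem_image, Finset.mem_image]
  rw [hc, Finset.filter_union, Finset.card_union_of_disjoint, Finset.filter_image,
    Finset.filter_image, Finset.card_image_of_injective, Finset.card_image_of_injOn]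
  · intro y hy z hz h
    have hy' : y ∈ x.clique := (Finset.mem_filter.1 hy).1
    have h' := congrArg (fun D => liftNode y ∈ D) h
    by_contra hyz
    simp only [Finset.mem_insert, liftNode_ne_last, Finset.mem_map', Finset.mem_erase, hy',
      false_or, ne_eq, not_true_eq_false, hyz, not_false_eq_true, and_true,
      eq_iff_iff, iff_true] at h'
  · exact fun C D h => Finset.map_injective _ h
  · rw [Finset.disjoint_left]
    intro D h1 h2
    obtain ⟨C, _, rfl⟩ := Finset.mem_image.1 (Finset.mem_filter.1 h1).1
    obtain ⟨y, _, h⟩ := Finset.mem_image.1 (Finset.mem_filter.1 h2).1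
    exact last_notMem_map C (h ▸ Finset.mem_insert_self _ _)

lemma outDegree_attachAt (T : OrderedIncreasingKTree k n) (x : T.Place) (a : Fin k) :
    (T.attachAt x).outDegree (Sum.inl a) =
      T.outDegree (Sum.inl a) + if Sum.inl a ∈ x.clique then 1 else 0 := by
  have hp : (T.attachAt x).parents = snocParents T.parents x.clique := rfl
  rw [outDegree, outDegree, Finset.card_filter, Finset.card_filter, Fin.sum_univ_castSucc, hp]
  simp only [snocParents_last, snocParents_castSucc, ← liftNode_inl (n := n), Finset.mem_map']

lemma cliques_size_zero (T : OrderedIncreasingKTree k 0) : T.cliques = {Finset.univ} := by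
  have hc : (Finset.univ : Finset (Node k 0)).card = k := by simp
  ext C
  rw [mem_cliques, Finset.mem_singleton]
  constructor
  · intro h
    exact Finset.eq_univ_of_card _ (h.2.trans (by simp))
  · rintro rfl
    have h := T.isRootedKTree.root_clique
    have : nodesUpTo k (∅ : Finset (Fin 0)) = Finset.univ := by
      ext w
      rcases w with a | j
      exacts [by simp [nodesUpTo], j.elim0]
    rwa [this] at h

lemma card_cliques (T : OrderedIncreasingKTree k n) : T.cliques.card = 1 + k * n := by
  induction n with
  | zero => simp [cliques_size_zero]
  | succ n ih =>
    obtain ⟨S, x, rfl⟩ := T.exists_attachAt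
    have h := card_filter_cliques_attachAt S x fun _ => True
    simp only [Finset.filter_true, card_place_clique, ih] at h
    rw [h]
    ring

/-- A new child of a root node lies together with this root node in `k - 1` new `k`-cliques. -/
lemma card_cliques_root (T : OrderedIncreasingKTree k n) (a : Fin k) :
    (T.cliques.filter fun C => Sum.inl a ∈ C).card =
      1 + (k - 1) * T.outDegree (Sum.inl a) := by
  induction n with
  | zero => simp [cliques_size_zero, outDegree, Finset.filter_singleton]
  | succ n ih =>
    obtain ⟨S, x, rfl⟩ := T.exists_attachAt
    rw [card_filter_cliques_attachAt, outDegree_attachAt]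
    simp only [← liftNode_inl (n := n), Finset.mem_map', Finset.mem_insert,
      liftNode_ne_last, false_or]
    rw [ih]
    have : (x.clique.filter fun y => Sum.inl a ∈ x.clique.erase y).card =
        (k - 1) * if Sum.inl a ∈ x.clique then 1 else 0 := by
      split_ifs with h
      · have : (x.clique.filter fun y => Sum.inl a ∈ x.clique.erase y) =
            x.clique.erase (Sum.inl a) := by
          ext y
          simp only [Finset.mem_filter, Finset.mem_erase, h, and_true, ne_comm (a := y)]
          exact and_comm
        rw [this, Finset.card_erase_of_mem h, card_place_clique, mul_one]
      · rw [mul_zero, Finset.card_eq_zero, Finset.filter_eq_empty_iff]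
        intro y _ h'
        exact h (Finset.mem_of_mem_erase h')
    rw [this]
    ring

noncomputable instance : Fintype (OrderedIncreasingKTree k n) := Fintype.ofFinite _

lemma outDegree_le (T : OrderedIncreasingKTree k n) (w : Node k n) : T.outDegree w ≤ n := by
  simpa [outDegree] using Finset.card_filter_le (Finset.univ : Finset (Fin n))
    fun j => w ∈ T.parents j

lemma sum_place (T : OrderedIncreasingKTree k n) (a : Fin k) (u v : ℝ) :
    ∑ x : T.Place, (if Sum.inl a ∈ x.clique then u else v) =
      (1 + k * T.outDegree (Sum.inl a)) * u +
      ((k + 1) * n - k * T.outDegree (Sum.inl a)) * v := by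
  have hk : 1 ≤ k := a.pos
  have h2 : ∀ x : T.Place, (if Sum.inl a ∈ x.clique then u else v) =
      (if Sum.inl a ∈ x.clique then 1 else 0) * (u - v) + v := by
    intro x
    split_ifs <;> ring
  have hcl : ∑ C : T.cliques, (if Sum.inl a ∈ (C : Finset (Node k n)) then (1 : ℝ) else 0) =
      1 + (k - 1) * T.outDegree (Sum.inl a) := by
    rw [Finset.sum_coe_sort T.cliques fun C => if Sum.inl a ∈ C then (1 : ℝ) else 0,
      Finset.sum_boole, card_cliques_root]
    push_cast [hk]
    ring
  have hnode : ∑ j : Fin n, (if Sum.inl a ∈ T.parents j then (1 : ℝ) else 0) =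
      T.outDegree (Sum.inl a) := by
    rw [Finset.sum_boole]
    rfl
  have hsum : ∑ x : T.Place, (if Sum.inl a ∈ x.clique then (1 : ℝ) else 0) =
      (1 + (k - 1) * T.outDegree (Sum.inl a)) + T.outDegree (Sum.inl a) := by
    rw [Fintype.sum_sum_type]
    exact congrArg₂ (· + ·) hcl hnode
  simp only [h2]
  rw [Finset.sum_add_distrib, ← Finset.sum_mul, hsum, Finset.sum_const, Finset.card_univ, Fintype.card_sum, Fintype.card_coe,
    card_cliques, Fintype.card_fin, nsmul_eq_mul]
  push_cast
  ring

/-- A root node of out-degree `d` gains a child at `1 + k d` of the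
`(k + 1) n + 1` places. -/
lemma sum_outDegree_succ (k n : ℕ) (a : Fin k) (f : ℕ → ℝ) :
    ∑ T : OrderedIncreasingKTree k (n + 1), f (T.outDegree (Sum.inl a)) =
      ∑ T : OrderedIncreasingKTree k n,
        ((1 + k * T.outDegree (Sum.inl a)) * f (T.outDegree (Sum.inl a) + 1) +
          ((k + 1) * n - k * T.outDegree (Sum.inl a)) * f (T.outDegree (Sum.inl a))) := by
  rw [← (attachEquiv k n).sum_comp, Fintype.sum_sigma]
  refine Finset.sum_congr rfl fun T _ => ?_
  rw [← sum_place]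
  refine Finset.sum_congr rfl fun x _ => ?_
  have : attachEquiv k n ⟨T, x⟩ = T.attachAt x := rfl
  rw [this, outDegree_attachAt]
  split_ifs <;> simp

end OrderedIncreasingKTree

/-! ### The out-degree process -/

/-- The expectation of `f` of the out-degree of the root node `0_1`. -/
noncomputable def meanRootOutDegree {k : ℕ} (hk : 1 ≤ k) (n : ℕ) (f : ℕ → ℝ) : ℝ :=
  ∫ T, f (rootOutDegree hk n T) ∂randomKTree k n

open OrderedIncreasingKTree

lemma meanRootOutDegree_eq {k : ℕ} (hk : 1 ≤ k) (n : ℕ) (f : ℕ → ℝ) :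
    meanRootOutDegree hk n f = (∑ T : OrderedIncreasingKTree k n, f (rootOutDegree hk n T)) /
      Fintype.card (OrderedIncreasingKTree k n) := by
  have : randomKTree k n = (Measure.count (Set.univ : Set (OrderedIncreasingKTree k n)))⁻¹ •
      Measure.count := by
    rw [randomKTree, uniformOn, ProbabilityTheory.cond, Measure.restrict_univ]
  rw [meanRootOutDegree, this, integral_smul_measure, integral_fintype]
  · simp [Measure.count_apply, Measure.real, div_eq_inv_mul]
  · exact Integrable.of_finite

lemma meanRootOutDegree_succ {k : ℕ} (hk : 1 ≤ k) (n : ℕ) (f : ℕ → ℝ) :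
    meanRootOutDegree hk (n + 1) f =
      meanRootOutDegree hk n (fun d => (1 + k * d) * f (d + 1) + ((k + 1) * n - k * d) * f d) /
        ((k + 1) * n + 1) := by
  have hcard : (Fintype.card (OrderedIncreasingKTree k (n + 1)) : ℝ) =
      Fintype.card (OrderedIncreasingKTree k n) * ((k + 1) * n + 1) := by
    have := sum_outDegree_succ k n ⟨0, hk⟩ fun _ => 1
    simp only [Finset.sum_const, Finset.card_univ, nsmul_eq_mul, mul_one] at this
    rw [this, ← nsmul_eq_mul, ← Finset.card_univ, ← Finset.sum_const]
    exact Finset.sum_congr rfl fun T _ => by ring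
  rw [meanRootOutDegree_eq, meanRootOutDegree_eq, hcard, div_div]
  congr 1
  exact sum_outDegree_succ k n ⟨0, hk⟩ f

lemma meanRootOutDegree_zero {k : ℕ} (hk : 1 ≤ k) (f : ℕ → ℝ) :
    meanRootOutDegree hk 0 f = f 0 := by
  have : ∀ T, rootOutDegree hk 0 T = 0 := fun T => Nat.le_zero.1 (T.outDegree_le _)
  simp [meanRootOutDegree, this]

end KTree

/-! ### The method of moments -/

section Moments

open scoped Topology BoundedContinuousFunction

/-- The remainder of the exponential series on the imaginary axis; the cases `c = ± I` cover its two
halves. -/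
lemma norm_cexp_sub_sum_le {c : ℂ} (hc : ‖c‖ = 1) (hre : c.re = 0) (N : ℕ) {x : ℝ} (hx : 0 ≤ x) :
    ‖Complex.exp (x * c) - ∑ s ∈ Finset.range N, (x * c) ^ s / (s.factorial : ℂ)‖ ≤
      x ^ N / N.factorial := by
  induction N generalizing x with
  | zero => simp [Complex.norm_exp, hre]
  | succ N ih =>
    have hd : ∀ y : ℝ, HasDerivAt (fun y : ℝ => Complex.exp (y * c) -
        ∑ s ∈ Finset.range (N + 1), (y * c) ^ s / (s.factorial : ℂ))
        (c * (Complex.exp (y * c) -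
          ∑ s ∈ Finset.range N, (y * c) ^ s / (s.factorial : ℂ))) y := by
      intro y
      have h0 : HasDerivAt (fun y : ℝ => (y : ℂ) * c) c y := by
        simpa using (Complex.ofRealCLM.hasDerivAt (x := y)).mul_const c
      have h1 := h0.cexp
      have h2 : HasDerivAt (fun y : ℝ => ∑ s ∈ Finset.range (N + 1),
          ((y : ℂ) * c) ^ s / (s.factorial : ℂ))
          (∑ s ∈ Finset.range (N + 1), s * ((y : ℂ) * c) ^ (s - 1) * c / (s.factorial : ℂ)) y :=
        HasDerivAt.fun_sum fun s _ => (h0.pow s).div_const _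
      refine (h1.fun_sub h2).congr_deriv ?_
      rw [Finset.sum_range_succ']
      simp only [Nat.cast_zero, zero_mul, zero_div, add_zero, mul_sub, Finset.mul_sum]
      congr 1
      · ring
      · refine Finset.sum_congr rfl fun s _ => ?_
        rw [Nat.factorial_succ, Nat.add_sub_cancel]
        have h1 : (s.factorial : ℂ) ≠ 0 := by exact_mod_cast s.factorial_ne_zero
        have h2 : ((s : ℂ) + 1) ≠ 0 := by exact_mod_cast s.succ_ne_zero
        push_cast
        field_simp
    have hB : ∀ y : ℝ, HasDerivAt (fun y : ℝ => y ^ (N + 1) / ((N + 1).factorial : ℝ))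
        (y ^ N / N.factorial) y := by
      intro y
      refine ((hasDerivAt_pow (N + 1) y).div_const ((N + 1).factorial : ℝ)).congr_deriv ?_
      rw [Nat.factorial_succ, Nat.add_sub_cancel]
      have h1 : (N.factorial : ℝ) ≠ 0 := by exact_mod_cast N.factorial_ne_zero
      push_cast
      field_simp
    refine image_norm_le_of_norm_deriv_right_le_deriv_boundary (a := 0) (b := x)
      (fun y _ => (hd y).continuousAt.continuousWithinAt) (fun y _ => (hd y).hasDerivWithinAt)
      ?_ hB ?_ ⟨hx, le_rfl⟩
    · simp [Finset.sum_range_succ']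
    · intro y hy
      rw [norm_mul, hc, one_mul]
      exact ih hy.1

lemma norm_cexp_mul_I_sub_sum_le (N : ℕ) (x : ℝ) :
    ‖Complex.exp (x * Complex.I) -
      ∑ s ∈ Finset.range N, (x * Complex.I) ^ s / (s.factorial : ℂ)‖ ≤ |x| ^ N / N.factorial := by
  rcases le_total 0 x with hx | hx
  · rw [abs_of_nonneg hx]
    exact norm_cexp_sub_sum_le (by simp) (by simp) N hx
  · rw [abs_of_nonpos hx]
    have := norm_cexp_sub_sum_le (c := -Complex.I) (by simp) (by simp) N (neg_nonneg.2 hx)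
    simpa using this

/-- The characteristic function is close to the Taylor polynomial formed with the moments. -/
lemma norm_charFun_sub_sum_le (μ : Measure ℝ) [IsProbabilityMeasure μ]
    (hμ : ∀ s : ℕ, Integrable (fun x : ℝ => x ^ s) μ) (r : ℕ) (t : ℝ) :
    ‖charFun μ t - ∑ s ∈ Finset.range (2 * r),
      (t * Complex.I) ^ s / (s.factorial : ℂ) * ((∫ x, x ^ s ∂μ : ℝ) : ℂ)‖ ≤
      t ^ (2 * r) * (∫ x, x ^ (2 * r) ∂μ) / (2 * r).factorial := by
  have hterm : ∀ s : ℕ, Integrable (fun x : ℝ =>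
      (t * Complex.I) ^ s / (s.factorial : ℂ) * ((x ^ s : ℝ) : ℂ)) μ :=
    fun s => (hμ s).ofReal.const_mul _
  have hexp : Integrable (fun x : ℝ => Complex.exp (t * x * Complex.I)) μ := by
    refine (integrable_const (1 : ℝ)).mono' (by fun_prop) (ae_of_all _ fun x => ?_)
    rw [← Complex.ofReal_mul, Complex.norm_exp_ofReal_mul_I]
  have h1 : charFun μ t - ∑ s ∈ Finset.range (2 * r),
      (t * Complex.I) ^ s / (s.factorial : ℂ) * ((∫ x, x ^ s ∂μ : ℝ) : ℂ) =
      ∫ x, (Complex.exp (t * x * Complex.I) - ∑ s ∈ Finset.range (2 * r),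
        (t * Complex.I) ^ s / (s.factorial : ℂ) * ((x ^ s : ℝ) : ℂ)) ∂μ := by
    rw [integral_sub hexp (integrable_finsetSum _ fun s _ => hterm s),
      integral_finsetSum _ fun s _ => hterm s, charFun_apply_real]
    congr 1
    refine Finset.sum_congr rfl fun s _ => ?_
    rw [integral_const_mul, integral_complex_ofReal]
  have h2 : t ^ (2 * r) * (∫ x, x ^ (2 * r) ∂μ) / (2 * r).factorial =
      ∫ x, t ^ (2 * r) * x ^ (2 * r) / (2 * r).factorial ∂μ := by
    rw [integral_div, integral_const_mul]
  rw [h1, h2]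
  refine norm_integral_le_of_norm_le (((hμ _).const_mul _).div_const _) (ae_of_all _ fun x => ?_)
  have h3 := norm_cexp_mul_I_sub_sum_le (2 * r) (t * x)
  rw [(even_two_mul r).pow_abs, mul_pow] at h3
  have h4 : ∀ s : ℕ, (((t * x : ℝ) : ℂ) * Complex.I) ^ s =
      (t * Complex.I) ^ s * ((x ^ s : ℝ) : ℂ) := by
    intro s
    push_cast
    ring
  simp only [h4] at h3
  simpa only [mul_div_right_comm, Complex.ofReal_mul] using h3

/-- A distribution whose moments grow slowly is determined by them, as its characteristic function
is the sum of its Taylor series. -/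
theorem ext_of_moments {μ ν : Measure ℝ} [IsProbabilityMeasure μ] [IsProbabilityMeasure ν]
    (hμ : ∀ s : ℕ, Integrable (fun x : ℝ => x ^ s) μ)
    (hν : ∀ s : ℕ, Integrable (fun x : ℝ => x ^ s) ν)
    (heq : ∀ s : ℕ, ∫ x, x ^ s ∂μ = ∫ x, x ^ s ∂ν)
    (hgrowth : ∀ t : ℝ, Tendsto
      (fun r : ℕ => t ^ (2 * r) * (∫ x, x ^ (2 * r) ∂μ) / (2 * r).factorial) atTop (𝓝 0)) :
    μ = ν := by
  refine Measure.ext_of_charFun (funext fun t => ?_)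
  have hlim : ∀ (ρ : Measure ℝ) [IsProbabilityMeasure ρ],
      (∀ s : ℕ, Integrable (fun x : ℝ => x ^ s) ρ) →
      (∀ s : ℕ, ∫ x, x ^ s ∂μ = ∫ x, x ^ s ∂ρ) →
      Tendsto (fun r : ℕ => ∑ s ∈ Finset.range (2 * r),
        (t * Complex.I) ^ s / (s.factorial : ℂ) * ((∫ x, x ^ s ∂μ : ℝ) : ℂ)) atTop
        (𝓝 (charFun ρ t)) := by
    intro ρ _ hρ he
    rw [tendsto_iff_norm_sub_tendsto_zero]
    refine squeeze_zero (fun _ => norm_nonneg _) (fun r => ?_) (hgrowth t)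
    rw [norm_sub_rev]
    simp only [he]
    exact norm_charFun_sub_sum_le ρ hρ r t
  exact tendsto_nhds_unique (hlim μ hμ fun _ => rfl) (hlim ν hν heq)

/-- The truncation of `x ^ s` to `[-R, R]`, as a bounded continuous function. -/
noncomputable def truncPow (s : ℕ) (R : ℝ) : ℝ →ᵇ ℝ :=
  BoundedContinuousFunction.ofNormedAddCommGroup (fun x : ℝ => max (-|R|) (min (x ^ s) |R|))
    (by fun_prop) |R| (fun x => by
      rw [Real.norm_eq_abs, abs_le]
      exact ⟨le_max_left _ _, max_le ((neg_nonpos.2 (abs_nonneg R)).trans (abs_nonneg R))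
        (min_le_right _ _)⟩)

lemma truncPow_apply (s : ℕ) {R : ℝ} (hR : 0 ≤ R) (x : ℝ) :
    truncPow s R x = max (-R) (min (x ^ s) R) := by
  simp [truncPow, abs_of_nonneg hR]

lemma abs_pow_sub_truncPow_le (s : ℕ) {R : ℝ} (hR : 0 < R) (x : ℝ) :
    |x ^ s - truncPow s R x| ≤ x ^ (2 * s) / R := by
  rw [truncPow_apply s hR.le, mul_comm, pow_mul, le_div_iff₀ hR]
  set y := x ^ s
  rcases le_total y R with h1 | h1
  · rw [min_eq_left h1]
    rcases le_total (-R) y with h2 | h2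
    · rw [max_eq_right h2]
      simpa using sq_nonneg y
    · rw [max_eq_left h2, abs_of_nonpos (by linarith)]
      nlinarith
  · rw [min_eq_right h1, max_eq_right (by linarith), abs_of_nonneg (by linarith)]
    nlinarith

/-- If the moments converge along a weakly convergent family, their limits are the moments of the
weak limit. -/
theorem moments_of_tendsto {ι : Type*} {l : Filter ι} [l.NeBot] {μs : ι → ProbabilityMeasure ℝ}
    {μ : ProbabilityMeasure ℝ} {m : ℕ → ℝ}
    (hint : ∀ i, ∀ s : ℕ, Integrable (fun x : ℝ => x ^ s) (μs i : Measure ℝ))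
    (hlim : ∀ s : ℕ, Tendsto (fun i => ∫ x, x ^ s ∂(μs i : Measure ℝ)) l (𝓝 (m s)))
    (h : Tendsto μs l (𝓝 μ)) (s : ℕ) :
    Integrable (fun x : ℝ => x ^ s) (μ : Measure ℝ) ∧ ∫ x, x ^ s ∂(μ : Measure ℝ) = m s := by
  rw [ProbabilityMeasure.tendsto_iff_forall_integral_tendsto] at h
  have hle : ∀ (s : ℕ) {R : ℝ}, 0 ≤ R → ∀ x, truncPow (2 * s) R x ≤ x ^ (2 * s) := by
    intro s R hR x
    have : 0 ≤ x ^ (2 * s) := (even_two_mul s).pow_nonneg x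
    rw [truncPow_apply _ hR]
    exact max_le (by linarith) (min_le_left _ _)
  have hnn : ∀ (s : ℕ) {R : ℝ}, 0 ≤ R → ∀ x, 0 ≤ truncPow (2 * s) R x := by
    intro s R hR x
    have : 0 ≤ x ^ (2 * s) := (even_two_mul s).pow_nonneg x
    rw [truncPow_apply _ hR]
    exact le_max_of_le_right (le_min this hR)
  have htr : ∀ (s : ℕ) {R : ℝ}, 0 ≤ R → ∫ x, truncPow (2 * s) R x ∂(μ : Measure ℝ) ≤ m (2 * s) := by
    intro s R hR
    refine le_of_tendsto_of_tendsto' (h (truncPow (2 * s) R)) (hlim (2 * s)) fun i => ?_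
    exact integral_mono ((truncPow (2 * s) R).integrable _) (hint i _) (hle s hR)
  have hInt2 : ∀ s : ℕ, Integrable (fun x : ℝ => x ^ (2 * s)) (μ : Measure ℝ) := by
    intro s
    refine ⟨by fun_prop, ?_⟩
    rw [hasFiniteIntegral_iff_ofReal (ae_of_all _ fun x => (even_two_mul s).pow_nonneg x)]
    have hbd : ∀ R : ℕ, ∫⁻ x, ENNReal.ofReal (truncPow (2 * s) R x) ∂(μ : Measure ℝ) ≤
        ENNReal.ofReal (m (2 * s)) := by
      intro R
      rw [← ofReal_integral_eq_lintegral_ofReal ((truncPow (2 * s) R).integrable _)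
        (ae_of_all _ (hnn s R.cast_nonneg))]
      exact ENNReal.ofReal_le_ofReal (htr s R.cast_nonneg)
    have hmono : Tendsto (fun R : ℕ => ∫⁻ x, ENNReal.ofReal (truncPow (2 * s) R x) ∂(μ : Measure ℝ))
        atTop (𝓝 (∫⁻ x, ENNReal.ofReal (x ^ (2 * s)) ∂(μ : Measure ℝ))) := by
      refine lintegral_tendsto_of_tendsto_of_monotone (fun R => ?_) (ae_of_all _ fun x => ?_)
        (ae_of_all _ fun x => ?_)
      · exact ((truncPow (2 * s) R).continuous.measurable.ennreal_ofReal).aemeasurable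
      · intro R R' hR
        refine ENNReal.ofReal_le_ofReal ?_
        have hRR : (R : ℝ) ≤ R' := by exact_mod_cast hR
        have : 0 ≤ x ^ (2 * s) := (even_two_mul s).pow_nonneg x
        have h0 : (0 : ℝ) ≤ R := R.cast_nonneg
        rw [truncPow_apply _ R.cast_nonneg, truncPow_apply _ R'.cast_nonneg,
          max_eq_right (by linarith [le_min this h0]),
          max_eq_right (by linarith [le_min this (h0.trans hRR)])]
        exact min_le_min_left _ hRR
      · refine tendsto_const_nhds.congr' ?_
        obtain ⟨R₀, hR₀⟩ := exists_nat_ge (x ^ (2 * s))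
        filter_upwards [eventually_ge_atTop R₀] with R hR
        have hRR : (R₀ : ℝ) ≤ R := by exact_mod_cast hR
        have : 0 ≤ x ^ (2 * s) := (even_two_mul s).pow_nonneg x
        rw [truncPow_apply _ R.cast_nonneg, min_eq_left (hR₀.trans hRR),
          max_eq_right (by linarith)]
    exact (le_of_tendsto' hmono hbd).trans_lt ENNReal.ofReal_lt_top
  have hInt : ∀ s : ℕ, Integrable (fun x : ℝ => x ^ s) (μ : Measure ℝ) := by
    intro s
    refine ((integrable_const (1 : ℝ)).add (hInt2 s)).mono' (by fun_prop) (ae_of_all _ fun x => ?_)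
    rw [Real.norm_eq_abs, Pi.add_apply, mul_comm, pow_mul, abs_le]
    constructor <;> nlinarith [sq_nonneg (x ^ s - 1), sq_nonneg (x ^ s + 1)]
  refine ⟨hInt s, ?_⟩
  have herr : ∀ (ρ : ProbabilityMeasure ℝ),
      (∀ s : ℕ, Integrable (fun x : ℝ => x ^ s) (ρ : Measure ℝ)) → ∀ {R : ℝ}, 0 < R →
      |∫ x, x ^ s ∂(ρ : Measure ℝ) - ∫ x, truncPow s R x ∂(ρ : Measure ℝ)| ≤
        (∫ x, x ^ (2 * s) ∂(ρ : Measure ℝ)) / R := by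
    intro ρ hρ R hR
    rw [← integral_sub (hρ s) ((truncPow s R).integrable _), ← integral_div, ← Real.norm_eq_abs]
    exact norm_integral_le_of_norm_le ((hρ _).div_const _)
      (ae_of_all _ fun x => abs_pow_sub_truncPow_le s hR x)
  have hkey : ∀ R : ℕ, 0 < R → |∫ x, x ^ s ∂(μ : Measure ℝ) - m s| ≤
      ((∫ x, x ^ (2 * s) ∂(μ : Measure ℝ)) + m (2 * s)) / R := by
    intro R hR
    have hR' : (0 : ℝ) < R := by exact_mod_cast hR
    have h1 := herr μ hInt hR'
    have h2 : |m s - ∫ x, truncPow s R x ∂(μ : Measure ℝ)| ≤ m (2 * s) / R :=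
      le_of_tendsto_of_tendsto' (((hlim s).sub (h (truncPow s R))).abs)
        ((hlim (2 * s)).div_const _) fun i => herr (μs i) (hint i) hR'
    rw [abs_sub_comm] at h2
    rw [add_div]
    exact (abs_sub_le _ _ _).trans (add_le_add h1 h2)
  have hz : |∫ x, x ^ s ∂(μ : Measure ℝ) - m s| ≤ 0 := by
    refine ge_of_tendsto (tendsto_const_div_atTop_nhds_zero_nat
      ((∫ x, x ^ (2 * s) ∂(μ : Measure ℝ)) + m (2 * s))) ?_
    filter_upwards [eventually_gt_atTop 0] with R hR using hkey R hR
  exact sub_eq_zero.1 (abs_nonpos_iff.1 hz)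

/-- Bounded second moments give tightness, by Chebyshev's inequality. -/
lemma isTightMeasureSet_of_second_moment {S : Set (Measure ℝ)} {M : ℝ}
    (hS : ∀ μ ∈ S, IsProbabilityMeasure μ ∧ Integrable (fun x : ℝ => x ^ 2) μ ∧
      ∫ x, x ^ 2 ∂μ ≤ M) : IsTightMeasureSet S := by
  rw [isTightMeasureSet_iff_exists_isCompact_measure_compl_le]
  intro ε hε
  have hlim : Tendsto (fun R : ℕ => ENNReal.ofReal (M / R)) atTop (𝓝 0) := by
    simpa using ENNReal.tendsto_ofReal (tendsto_const_div_atTop_nhds_zero_nat M)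
  obtain ⟨R, hR, hR1⟩ := ((hlim.eventually (eventually_le_nhds hε)).and
    (eventually_ge_atTop 1)).exists
  refine ⟨Metric.closedBall 0 R, isCompact_closedBall _ _, fun μ hμ => ?_⟩
  obtain ⟨hp, hi, hM⟩ := hS μ hμ
  have hR' : (1 : ℝ) ≤ R := by exact_mod_cast hR1
  refine le_trans ?_ hR
  have h1 := mul_meas_ge_le_integral_of_nonneg (ae_of_all μ fun x => sq_nonneg x) hi R
  have h2 : (Metric.closedBall (0 : ℝ) R)ᶜ ⊆ {x : ℝ | (R : ℝ) ≤ x ^ 2} := by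
    intro x hx
    simp only [Set.mem_compl_iff, Metric.mem_closedBall, dist_zero_right, Real.norm_eq_abs,
      not_le] at hx
    have : x ^ 2 = |x| ^ 2 := (sq_abs x).symm
    simp only [Set.mem_ofPred_eq, this]
    nlinarith
  refine (measure_mono h2).trans ?_
  rw [← ofReal_measureReal]
  refine ENNReal.ofReal_le_ofReal ?_
  rw [le_div_iff₀ (by linarith), mul_comm]
  exact h1.trans hM

/-- The **method of moments**: by Prokhorov's theorem there is a cluster point, it has the limits
of the moments as its moments, and these determine it. -/
theorem exists_tendsto_of_moments {μs : ℕ → ProbabilityMeasure ℝ} {m : ℕ → ℝ}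
    (hint : ∀ n, ∀ s : ℕ, Integrable (fun x : ℝ => x ^ s) (μs n : Measure ℝ))
    (hlim : ∀ s : ℕ, Tendsto (fun n => ∫ x, x ^ s ∂(μs n : Measure ℝ)) atTop (𝓝 (m s)))
    (hgrowth : ∀ t : ℝ, Tendsto
      (fun r : ℕ => t ^ (2 * r) * m (2 * r) / (2 * r).factorial) atTop (𝓝 0)) :
    ∃ μ : ProbabilityMeasure ℝ, Tendsto μs atTop (𝓝 μ) ∧
      ∀ s : ℕ, Integrable (fun x : ℝ => x ^ s) (μ : Measure ℝ) ∧
        ∫ x, x ^ s ∂(μ : Measure ℝ) = m s := by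
  obtain ⟨M, hM⟩ := (hlim 2).bddAbove_range
  have hcomp : IsCompact (closure (Set.range μs)) := by
    refine isCompact_closure_of_isTightMeasureSet (isTightMeasureSet_of_second_moment (M := M) ?_)
    rintro _ ⟨_, ⟨n, rfl⟩, rfl⟩
    exact ⟨inferInstance, hint n 2, hM ⟨n, rfl⟩⟩
  have hmem : closure (Set.range μs) ∈ map μs atTop :=
    mem_map.2 (univ_mem' fun n => subset_closure ⟨n, rfl⟩)
  have hcl : ∀ ρ, MapClusterPt ρ atTop μs → ∀ s : ℕ,
      Integrable (fun x : ℝ => x ^ s) (ρ : Measure ℝ) ∧ ∫ x, x ^ s ∂(ρ : Measure ℝ) = m s := by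
    intro ρ hρ
    obtain ⟨U, hU, hUρ⟩ := mapClusterPt_iff_ultrafilter.1 hρ
    exact moments_of_tendsto hint (fun s => (hlim s).mono_left hU) hUρ
  obtain ⟨μ, _, hμ⟩ := hcomp.exists_mapClusterPt (f := atTop) (u := μs) (by
    exact le_principal_iff.2 hmem)
  refine ⟨μ, hcomp.le_nhds_of_unique_clusterPt hmem fun ρ _ hρ => ?_, hcl μ hμ⟩
  have h1 := hcl ρ hρ
  have h2 := hcl μ hμ
  have : (ρ : Measure ℝ) = μ := ext_of_moments (fun s => (h1 s).1) (fun s => (h2 s).1)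
    (fun s => (h1 s).2.trans (h2 s).2.symm) fun t => by simpa only [(h1 _).2] using hgrowth t
  exact Subtype.ext this

end Moments

namespace KTree

open OrderedIncreasingKTree
open scoped Topology

/-! ### The exact distribution of the out-degree -/

lemma multichoose_succ_mul (r : ℝ) (n : ℕ) :
    Ring.multichoose r (n + 1) * (n + 1) = Ring.multichoose r n * (r + n) := by
  have h : ∀ n : ℕ, (n.factorial : ℝ) * Ring.multichoose r n = (ascPochhammer ℝ n).eval r := by
    intro n
    rw [← nsmul_eq_mul, Ring.factorial_nsmul_multichoose_eq_ascPochhammer,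
      Polynomial.ascPochhammer_smeval_eq_eval]
  have h1 := h (n + 1)
  rw [ascPochhammer_succ_eval, ← h n, Nat.factorial_succ] at h1
  have h2 : (n.factorial : ℝ) ≠ 0 := by exact_mod_cast n.factorial_ne_zero
  push_cast at h1
  apply mul_left_cancel₀ h2
  linarith

lemma multichoose_pos {r : ℝ} (hr : 0 < r) (n : ℕ) : 0 < Ring.multichoose r n := by
  induction n with
  | zero => simp
  | succ n ih =>
    have h := multichoose_succ_mul r n
    have h1 : 0 < Ring.multichoose r n * (r + n) := by positivity
    rw [← h] at h1
    exact pos_of_mul_pos_left h1 (by positivity)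

/-- The alternating sum in the distribution of the out-degree, where `c = k / (k + 1)`. -/
noncomputable def alternatingSum (c : ℝ) (n m : ℕ) : ℝ :=
  ∑ l ∈ Finset.range (m + 1), (m.choose l : ℝ) * (-1) ^ l * Ring.multichoose (-(c * l)) n

lemma alternatingSum_zero (c : ℝ) (m : ℕ) : alternatingSum c 0 m = if m = 0 then 1 else 0 := by
  have h := Int.alternating_sum_range_choose (n := m)
  have h' : ((∑ l ∈ Finset.range (m + 1), (-1) ^ l * (m.choose l : ℤ) : ℤ) : ℝ) =
      ((if m = 0 then 1 else 0 : ℤ) : ℝ) := by rw [h]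
  push_cast at h'
  simp only [alternatingSum, Ring.multichoose_zero_right, mul_one]
  rw [← h']
  exact Finset.sum_congr rfl fun l _ => mul_comm _ _

lemma alternatingSum_succ_zero (c : ℝ) (n : ℕ) : alternatingSum c (n + 1) 0 = 0 := by
  simp [alternatingSum, Ring.multichoose_zero_succ]

lemma alternatingSum_succ (c : ℝ) (n m : ℕ) :
    alternatingSum c (n + 1) (m + 1) * (n + 1) = c * (m + 1) * alternatingSum c n m +
      (n - c * (m + 1)) * alternatingSum c n (m + 1) := by
  have h1 : alternatingSum c n m = ∑ l ∈ Finset.range (m + 1 + 1),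
      (m.choose l : ℝ) * (-1) ^ l * Ring.multichoose (-(c * l)) n := by
    rw [Finset.sum_range_succ, Nat.choose_succ_self]
    simp [alternatingSum]
  rw [h1, alternatingSum, alternatingSum, Finset.sum_mul, Finset.mul_sum, Finset.mul_sum,
    ← Finset.sum_add_distrib]
  refine Finset.sum_congr rfl fun l hl => ?_
  have hl' : l ≤ m + 1 := by
    have := Finset.mem_range.1 hl
    omega
  have h2 : (m.choose l : ℝ) * (m + 1) = ((m + 1).choose l : ℝ) * (m + 1 - l) := by
    have := Nat.choose_mul_succ_eq m l
    rw [← Nat.cast_inj (R := ℝ)] at this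
    push_cast [hl'] at this
    exact this
  rw [mul_assoc, multichoose_succ_mul]
  linear_combination (-c * (-1) ^ l * Ring.multichoose (-(c * l)) n) * h2

lemma meanRootOutDegree_add_mul {k : ℕ} (hk : 1 ≤ k) (n : ℕ) (u v : ℝ) (f g : ℕ → ℝ) :
    meanRootOutDegree hk n (fun d => u * f d + v * g d) =
      u * meanRootOutDegree hk n f + v * meanRootOutDegree hk n g := by
  rw [meanRootOutDegree, integral_add Integrable.of_finite Integrable.of_finite,
    integral_const_mul, integral_const_mul]
  rfl

lemma meanRootOutDegree_mono {k : ℕ} (hk : 1 ≤ k) (n : ℕ) {f g : ℕ → ℝ} (h : ∀ d, f d ≤ g d) :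
    meanRootOutDegree hk n f ≤ meanRootOutDegree hk n g :=
  integral_mono Integrable.of_finite Integrable.of_finite fun _ => h _

lemma measureReal_rootOutDegree_eq {k : ℕ} (hk : 1 ≤ k) (n m : ℕ) :
    (randomKTree k n).real {T | rootOutDegree hk n T = m} =
      meanRootOutDegree hk n fun d => if d = m then 1 else 0 := by
  rw [meanRootOutDegree, ← integral_indicator_one (MeasurableSet.of_discrete)]
  refine integral_congr_ae (ae_of_all _ fun T => ?_)
  simp [Set.indicator_apply]

theorem meanRootOutDegree_single {k : ℕ} (hk : 1 ≤ k) (n m : ℕ) :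
    meanRootOutDegree hk n (fun d => if d = m then 1 else 0) =
      Ring.multichoose (1 / (k : ℝ)) m / Ring.multichoose (1 / ((k : ℝ) + 1)) n *
        alternatingSum ((k : ℝ) / (k + 1)) n m := by
  have hk0 : (0 : ℝ) < k := by exact_mod_cast hk
  induction n generalizing m with
  | zero =>
    rw [meanRootOutDegree_zero, alternatingSum_zero]
    rcases m with _ | m <;> simp
  | succ n ih =>
    have hB := multichoose_pos (r := 1 / ((k : ℝ) + 1)) (by positivity) n
    have hB' := multichoose_pos (r := 1 / ((k : ℝ) + 1)) (by positivity) (n + 1)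
    have hBs := multichoose_succ_mul (1 / ((k : ℝ) + 1)) n
    have hn : (0 : ℝ) < (k + 1) * n + 1 := by positivity
    rw [meanRootOutDegree_succ, div_eq_iff hn.ne']
    rcases m with _ | m
    · have : (fun d : ℕ => (1 + k * d) * (if d + 1 = 0 then 1 else 0 : ℝ) +
          ((k + 1) * n - k * d) * (if d = 0 then 1 else 0)) =
          fun d : ℕ => ((k + 1) * n) * (if d = 0 then 1 else 0 : ℝ) + 0 * 0 := by
        funext d
        rcases d with _ | d <;> simp
      rw [this, meanRootOutDegree_add_mul hk n _ _ _ fun _ => 0, ih, alternatingSum_succ_zero]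
      rcases n with _ | n
      · simp
      · rw [alternatingSum_succ_zero]
        simp
    · have : (fun d : ℕ => (1 + k * d) * (if d + 1 = m + 1 then 1 else 0 : ℝ) +
          ((k + 1) * n - k * d) * (if d = m + 1 then 1 else 0)) =
          fun d : ℕ => (1 + k * m) * (if d = m then 1 else 0 : ℝ) +
            ((k + 1) * n - k * (m + 1)) * (if d = m + 1 then 1 else 0) := by
        funext d
        rcases eq_or_ne d m with rfl | h1
        · simp
        · rcases eq_or_ne d (m + 1) with rfl | h2
          · simp
          · simp [h1, h2]
      have hA := multichoose_succ_mul (1 / (k : ℝ)) m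
      have hS := alternatingSum_succ ((k : ℝ) / (k + 1)) n m
      rw [this, meanRootOutDegree_add_mul, ih, ih]
      set A := Ring.multichoose (1 / (k : ℝ)) m
      set A' := Ring.multichoose (1 / (k : ℝ)) (m + 1)
      set B := Ring.multichoose (1 / ((k : ℝ) + 1)) n
      set B' := Ring.multichoose (1 / ((k : ℝ) + 1)) (n + 1)
      set S := alternatingSum ((k : ℝ) / (k + 1)) n m
      set S' := alternatingSum ((k : ℝ) / (k + 1)) n (m + 1)
      set U := alternatingSum ((k : ℝ) / (k + 1)) (n + 1) (m + 1)
      have hA2 : (1 + k * m) * A = k * (m + 1) * A' := by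
        field_simp at hA
        linarith
      have hB2 : ((k : ℝ) + 1) * (n + 1) * B' = B * ((k + 1) * n + 1) := by
        field_simp at hBs
        linarith
      have hS2 : ((k : ℝ) + 1) * (n + 1) * U =
          k * (m + 1) * S + ((k + 1) * n - k * (m + 1)) * S' := by
        field_simp at hS
        linarith
      have h3 : A' / B' * U * ((k + 1) * n + 1) = A' / B * (((k : ℝ) + 1) * (n + 1) * U) := by
        field_simp
        linear_combination (-A' * U) * hB2
      rw [h3, hS2]
      field_simp
      linear_combination S * hA2

/-! ### The limits of the moments -/

lemma Gamma_add_natCast {x : ℝ} (hx : 0 < x) (s : ℕ) :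
    Real.Gamma (x + s) = Real.Gamma x * (ascPochhammer ℝ s).eval x := by
  induction s with
  | zero => simp
  | succ s ih =>
    rw [ascPochhammer_succ_eval, ← mul_assoc, ← ih, Nat.cast_succ, ← add_assoc,
      Real.Gamma_add_one (by positivity), mul_comm]

lemma eval_add_one_ascPochhammer_mul (s : ℕ) (x : ℝ) :
    x * (ascPochhammer ℝ s).eval (x + 1) = (ascPochhammer ℝ s).eval x * (x + s) := by
  rw [← ascPochhammer_succ_eval, ascPochhammer_succ_left]
  simp

/-- The rising factorials of `Y + 1 / k` have explicit expectations, since each step of the process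
multiplies them by a constant. -/
lemma meanRootOutDegree_ascPochhammer {k : ℕ} (hk : 1 ≤ k) (n s : ℕ) :
    meanRootOutDegree hk n (fun d => (ascPochhammer ℝ s).eval (d + 1 / (k : ℝ))) =
      (ascPochhammer ℝ s).eval (1 / (k : ℝ)) * ∏ i ∈ Finset.range n,
        ((1 / ((k : ℝ) + 1) + (k : ℝ) / (k + 1) * s + i) / (1 / ((k : ℝ) + 1) + i)) := by
  have hk0 : (0 : ℝ) < k := by exact_mod_cast hk
  induction n with
  | zero => simp [meanRootOutDegree_zero]
  | succ n ih =>
    rw [Finset.prod_range_succ, ← mul_assoc, ← ih, meanRootOutDegree_succ]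
    have : (fun d : ℕ => (1 + k * d) *
          (ascPochhammer ℝ s).eval (((d + 1 : ℕ) : ℝ) + 1 / (k : ℝ)) +
        ((k + 1) * n - k * d) * (ascPochhammer ℝ s).eval (d + 1 / (k : ℝ))) =
        fun d : ℕ => ((k + 1) * n + 1 + k * s) * (ascPochhammer ℝ s).eval (d + 1 / (k : ℝ)) +
          0 * 0 := by
      funext d
      have h := eval_add_one_ascPochhammer_mul s (d + 1 / (k : ℝ))
      have h1 : ((d + 1 : ℕ) : ℝ) + 1 / (k : ℝ) = d + 1 / (k : ℝ) + 1 := by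
        push_cast
        ring
      have h2 : (1 + k * d : ℝ) = k * (d + 1 / k) := by
        field_simp
        ring
      rw [h1, h2, mul_assoc, h]
      field_simp
      ring
    rw [this, meanRootOutDegree_add_mul hk n _ _ _ fun _ => 0]
    have hn : (0 : ℝ) < (k + 1) * n + 1 := by positivity
    have hn' : (1 / ((k : ℝ) + 1) + n) = ((k + 1) * n + 1) / (k + 1) := by
      field_simp
      ring
    have hn2 : (1 / ((k : ℝ) + 1) + (k : ℝ) / (k + 1) * s + n) =
        ((k + 1) * n + 1 + k * s) / (k + 1) := by
      field_simp
      ring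
    rw [hn', hn2]
    field_simp
    ring

lemma tendsto_prod_ratio {a u : ℝ} (ha : 0 < a) (hu : 0 ≤ u) :
    Tendsto (fun n : ℕ => (n : ℝ) ^ (-u) * ∏ i ∈ Finset.range n, ((a + u + i) / (a + i))) atTop
      (𝓝 (Real.Gamma a / Real.Gamma (a + u))) := by
  have hau : 0 < a + u := by positivity
  have h1 := (Real.GammaSeq_tendsto_Gamma a).div (Real.GammaSeq_tendsto_Gamma (a + u))
    (Real.Gamma_pos_of_pos hau).ne'
  have h2 : Tendsto (fun n : ℕ => (a + n) / (a + u + n)) atTop (𝓝 1) := by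
    have h : Tendsto (fun n : ℕ => 1 - u / (n + (a + u))) atTop (𝓝 (1 - 0)) :=
      tendsto_const_nhds.sub (tendsto_const_nhds.div_atTop
        (tendsto_atTop_add_const_right _ _ tendsto_natCast_atTop_atTop))
    rw [sub_zero] at h
    refine h.congr fun n => ?_
    have : (0 : ℝ) < a + u + n := by positivity
    field_simp
    ring
  have h3 := h1.mul h2
  rw [mul_one] at h3
  refine h3.congr' ?_
  filter_upwards [eventually_gt_atTop 0] with n hn
  have hn' : (0 : ℝ) < n := by exact_mod_cast hn
  have hp : ∀ x : ℝ, 0 < x → 0 < ∏ i ∈ Finset.range n, (x + (i : ℝ)) := fun x hx =>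
    Finset.prod_pos fun i _ => by positivity
  have hp1 := hp a ha
  have hp2 := hp (a + u) hau
  have hf : (0 : ℝ) < n.factorial := by exact_mod_cast n.factorial_pos
  have hr : (n : ℝ) ^ (a + u) = (n : ℝ) ^ a * (n : ℝ) ^ u := Real.rpow_add hn' _ _
  have hr1 : 0 < (n : ℝ) ^ a := Real.rpow_pos_of_pos hn' _
  have hr2 : 0 < (n : ℝ) ^ u := Real.rpow_pos_of_pos hn' _
  have e1 : 0 < a + n := by positivity
  have e2 : 0 < a + u + n := by positivity
  simp only [Pi.div_apply, Real.GammaSeq, Finset.prod_range_succ, Finset.prod_div_distrib]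
  rw [Real.rpow_neg hn'.le, hr]
  field_simp

/-- The moments of the limit distribution. -/
noncomputable def limitMoment (k s : ℕ) : ℝ :=
  Real.Gamma (1 / ((k : ℝ) + 1)) * Real.Gamma ((s : ℝ) + 1 / k) /
    (Real.Gamma (1 / (k : ℝ)) * Real.Gamma ((k : ℝ) / (k + 1) * s + 1 / ((k : ℝ) + 1)))

lemma limitMoment_eq {k : ℕ} (hk : 1 ≤ k) (s : ℕ) :
    limitMoment k s = (ascPochhammer ℝ s).eval (1 / (k : ℝ)) *
      (Real.Gamma (1 / ((k : ℝ) + 1)) /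
        Real.Gamma (1 / ((k : ℝ) + 1) + (k : ℝ) / (k + 1) * s)) := by
  have hk0 : (0 : ℝ) < k := by exact_mod_cast hk
  have h1 : Real.Gamma (1 / (k : ℝ)) ≠ 0 := (Real.Gamma_pos_of_pos (by positivity)).ne'
  have h2 : Real.Gamma (1 / ((k : ℝ) + 1) + (k : ℝ) / (k + 1) * s) ≠ 0 :=
    (Real.Gamma_pos_of_pos (by positivity)).ne'
  rw [limitMoment, add_comm (s : ℝ), Gamma_add_natCast (by positivity), add_comm (_ * (s : ℝ))]
  field_simp

/-- Powers and rising factorials differ in lower order only. -/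
lemma exists_pow_ascPochhammer_bound {b : ℝ} (hb : 0 ≤ b) (s : ℕ) :
    ∃ D : ℝ, ∀ d : ℕ, (d : ℝ) ^ (s + 1) ≤ (ascPochhammer ℝ (s + 1)).eval (d + b) ∧
      (ascPochhammer ℝ (s + 1)).eval (d + b) - D * (ascPochhammer ℝ s).eval (d + b) ≤
        (d : ℝ) ^ (s + 1) := by
  have hnn : ∀ (s d : ℕ), 0 ≤ (ascPochhammer ℝ s).eval (d + b) := by
    intro s d
    induction s with
    | zero => simp
    | succ s ih =>
      rw [ascPochhammer_succ_eval]
      positivity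
  induction s with
  | zero => exact ⟨b, fun d => by simp [hb]⟩
  | succ s ih =>
    obtain ⟨D, hD⟩ := ih
    refine ⟨|D| + b + (s + 1), fun d => ?_⟩
    obtain ⟨h1, h2⟩ := hD d
    have hs := hnn s d
    have hs1 := hnn (s + 1) d
    have hd : (0 : ℝ) ≤ d := d.cast_nonneg
    have e1 := ascPochhammer_succ_eval (s + 1) ((d : ℝ) + b)
    have e2 := ascPochhammer_succ_eval s ((d : ℝ) + b)
    push_cast at e1
    rw [e1, pow_succ]
    constructor
    · have := mul_le_mul_of_nonneg_right h1 hd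
      nlinarith [mul_nonneg hs1 (by positivity : (0 : ℝ) ≤ b + (s + 1))]
    · have h3 : (d : ℝ) * (ascPochhammer ℝ s).eval (d + b) ≤
          (ascPochhammer ℝ (s + 1)).eval (d + b) := by
        rw [e2]
        nlinarith [mul_nonneg hs (by positivity : (0 : ℝ) ≤ b + s)]
      have h4 : D * ((d : ℝ) * (ascPochhammer ℝ s).eval (d + b)) ≤
          |D| * (ascPochhammer ℝ (s + 1)).eval (d + b) :=
        (mul_le_mul_of_nonneg_right (le_abs_self D) (mul_nonneg hd hs)).trans
          (mul_le_mul_of_nonneg_left h3 (abs_nonneg D))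
      have h5 := mul_le_mul_of_nonneg_right h2 hd
      nlinarith

lemma tendsto_mean_ascPochhammer {k : ℕ} (hk : 1 ≤ k) (s : ℕ) :
    Tendsto (fun n : ℕ => (n : ℝ) ^ (-((k : ℝ) / (k + 1) * s)) *
      meanRootOutDegree hk n (fun d => (ascPochhammer ℝ s).eval (d + 1 / (k : ℝ)))) atTop
      (𝓝 (limitMoment k s)) := by
  have hk0 : (0 : ℝ) < k := by exact_mod_cast hk
  rw [limitMoment_eq hk]
  refine ((tendsto_prod_ratio (a := 1 / ((k : ℝ) + 1)) (u := (k : ℝ) / (k + 1) * s)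
    (by positivity) (by positivity)).const_mul ((ascPochhammer ℝ s).eval (1 / (k : ℝ)))).congr
      fun n => ?_
  rw [meanRootOutDegree_ascPochhammer]
  ring

lemma tendsto_mean_pow {k : ℕ} (hk : 1 ≤ k) (s : ℕ) :
    Tendsto (fun n : ℕ => (n : ℝ) ^ (-((k : ℝ) / (k + 1) * s)) *
      meanRootOutDegree hk n (fun d => (d : ℝ) ^ s)) atTop (𝓝 (limitMoment k s)) := by
  have hk0 : (0 : ℝ) < k := by exact_mod_cast hk
  rcases s with _ | s
  · simpa using tendsto_mean_ascPochhammer hk 0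
  obtain ⟨D, hD⟩ := exists_pow_ascPochhammer_bound (b := 1 / (k : ℝ)) (by positivity) s
  have hz : Tendsto (fun n : ℕ => (n : ℝ) ^ (-((k : ℝ) / (k + 1)))) atTop (𝓝 0) :=
    (tendsto_rpow_neg_atTop (by positivity)).comp tendsto_natCast_atTop_atTop
  have hlow := (tendsto_mean_ascPochhammer hk (s + 1)).sub
    ((hz.mul (tendsto_mean_ascPochhammer hk s)).const_mul D)
  rw [zero_mul, mul_zero, sub_zero] at hlow
  refine tendsto_of_tendsto_of_tendsto_of_le_of_le' hlow (tendsto_mean_ascPochhammer hk (s + 1))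
    ?_ ?_
  · filter_upwards [eventually_gt_atTop 0] with n hn
    have hn' : (0 : ℝ) < n := by exact_mod_cast hn
    have h1 := meanRootOutDegree_mono hk n fun d => (hD d).2
    have h2 := meanRootOutDegree_add_mul hk n 1 (-D)
      (fun d => (ascPochhammer ℝ (s + 1)).eval (d + 1 / (k : ℝ)))
      (fun d => (ascPochhammer ℝ s).eval (d + 1 / (k : ℝ)))
    simp only [one_mul, neg_mul, ← sub_eq_add_neg] at h2
    rw [h2] at h1
    have h3 : (n : ℝ) ^ (-((k : ℝ) / (k + 1) * ((s + 1 : ℕ) : ℝ))) =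
        (n : ℝ) ^ (-((k : ℝ) / (k + 1))) * (n : ℝ) ^ (-((k : ℝ) / (k + 1) * s)) := by
      rw [← Real.rpow_add hn']
      congr 1
      push_cast
      ring
    have h4 := mul_le_mul_of_nonneg_left h1
      (Real.rpow_nonneg hn'.le (-((k : ℝ) / (k + 1) * ((s + 1 : ℕ) : ℝ))))
    refine le_trans (le_of_eq ?_) h4
    rw [mul_sub, h3]
    ring
  · filter_upwards with n
    exact mul_le_mul_of_nonneg_left (meanRootOutDegree_mono hk n fun d => (hD d).1)
      (Real.rpow_nonneg n.cast_nonneg _)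

/-- The moments of the limit distribution grow so slowly that they determine it. -/
lemma limitMoment_growth {k : ℕ} (hk : 1 ≤ k) (t : ℝ) :
    Tendsto (fun r : ℕ => t ^ (2 * r) * limitMoment k (2 * r) / (2 * r).factorial) atTop
      (𝓝 0) := by
  have hk0 : (1 : ℝ) ≤ k := by exact_mod_cast hk
  have hG : 0 < Real.Gamma (1 / ((k : ℝ) + 1)) := Real.Gamma_pos_of_pos (by positivity)
  have hasc : ∀ s : ℕ, 0 ≤ (ascPochhammer ℝ s).eval (1 / (k : ℝ)) ∧
      (ascPochhammer ℝ s).eval (1 / (k : ℝ)) ≤ s.factorial := by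
    intro s
    refine ⟨(ascPochhammer_pos s _ (by positivity)).le, ?_⟩
    induction s with
    | zero => simp
    | succ s ih =>
      have hb : 1 / (k : ℝ) ≤ 1 := (div_le_one (by linarith)).2 hk0
      rw [ascPochhammer_succ_eval, Nat.factorial_succ, mul_comm, Nat.cast_mul]
      push_cast
      exact mul_le_mul (by linarith) ih (ascPochhammer_pos s _ (by positivity)).le (by positivity)
  rw [← tendsto_add_atTop_iff_nat 1]
  have hlim : Tendsto (fun r : ℕ => Real.Gamma (1 / ((k : ℝ) + 1)) * t ^ 2 *
      ((t ^ 2) ^ r / r.factorial)) atTop (𝓝 0) := by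
    simpa using (FloorSemiring.tendsto_pow_div_factorial_atTop (t ^ 2)).const_mul
      (Real.Gamma (1 / ((k : ℝ) + 1)) * t ^ 2)
  have hGpos : ∀ s : ℕ, 0 < Real.Gamma (1 / ((k : ℝ) + 1) + (k : ℝ) / (k + 1) * s) := fun s =>
    Real.Gamma_pos_of_pos (by positivity)
  refine squeeze_zero' ?_ ?_ hlim
  · filter_upwards with r
    have h1 := (hasc (2 * (r + 1))).1
    have h2 := hGpos (2 * (r + 1))
    have h3 := (even_two_mul (r + 1)).pow_nonneg t
    rw [limitMoment_eq hk]
    positivity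
  · filter_upwards [eventually_ge_atTop 1] with r hr
    have hr' : (1 : ℝ) ≤ r := by exact_mod_cast hr
    -- since `k / (k + 1) ≥ 1 / 2`, the Gamma function is evaluated beyond `r + 1`
    have hc : (r : ℝ) + 1 ≤ 1 / ((k : ℝ) + 1) + (k : ℝ) / (k + 1) * ((2 * (r + 1) : ℕ) : ℝ) := by
      have : (1 : ℝ) / 2 ≤ (k : ℝ) / (k + 1) := by
        rw [div_le_div_iff₀ (by norm_num) (by linarith)]
        linarith
      have h0 : 0 ≤ 1 / ((k : ℝ) + 1) := by positivity
      push_cast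
      nlinarith
    have hmon : (r.factorial : ℝ) ≤
        Real.Gamma (1 / ((k : ℝ) + 1) + (k : ℝ) / (k + 1) * ((2 * (r + 1) : ℕ) : ℝ)) := by
      rw [← Real.Gamma_nat_eq_factorial]
      exact Real.Gamma_strictMonoOn_Ici.monotoneOn (Set.mem_Ici.2 (by linarith))
        (Set.mem_Ici.2 (by linarith)) hc
    have hf : (0 : ℝ) < r.factorial := by exact_mod_cast r.factorial_pos
    have hf2 : (0 : ℝ) < (2 * (r + 1)).factorial := by exact_mod_cast (2 * (r + 1)).factorial_pos
    have h3 := (even_two_mul (r + 1)).pow_nonneg t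
    rw [limitMoment_eq hk, div_le_iff₀ hf2]
    have h4 : (ascPochhammer ℝ (2 * (r + 1))).eval (1 / (k : ℝ)) *
        (Real.Gamma (1 / ((k : ℝ) + 1)) / Real.Gamma
          (1 / ((k : ℝ) + 1) + (k : ℝ) / (k + 1) * ((2 * (r + 1) : ℕ) : ℝ))) ≤
        (2 * (r + 1)).factorial * (Real.Gamma (1 / ((k : ℝ) + 1)) / r.factorial) :=
      mul_le_mul (hasc _).2 (div_le_div_of_nonneg_left hG.le hf hmon)
        (div_pos hG (hGpos _)).le hf2.le
    refine (mul_le_mul_of_nonneg_left h4 h3).trans (le_of_eq ?_)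
    rw [mul_add, mul_one, pow_add, pow_mul]
    ring

end KTree

theorem theorem2 (k : ℕ) (hk : 1 ≤ k) :
    (∀ n m : ℕ,
      (KTree.randomKTree k n).real {T | KTree.rootOutDegree hk n T = m} =
        Ring.choose ((m : ℝ) - ((k : ℝ) - 1) / k) m /
            Ring.choose ((n : ℝ) - (k : ℝ) / (k + 1)) n *
          ∑ l ∈ Finset.range (m + 1),
            (m.choose l : ℝ) * (-1) ^ l *
              Ring.choose ((n : ℝ) - 1 - (k : ℝ) * l / (k + 1)) n) ∧
    ∃ (μ : Measure ℝ) (_ : IsProbabilityMeasure μ),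
      TendstoInDistribution
        (fun (n : ℕ) (T : KTree.OrderedIncreasingKTree k n) =>
          (n : ℝ) ^ (-((k : ℝ) / (k + 1))) * (KTree.rootOutDegree hk n T : ℝ))
        atTop (fun x : ℝ => x) (fun n => KTree.randomKTree k n) μ ∧
      (∀ s : ℕ,
        Integrable (fun x : ℝ => x ^ s) μ ∧
          ∫ x, x ^ s ∂μ =
            Real.Gamma (1 / ((k : ℝ) + 1)) * Real.Gamma ((s : ℝ) + 1 / k) /
              (Real.Gamma (1 / (k : ℝ)) *
                Real.Gamma ((k : ℝ) / (k + 1) * s + 1 / ((k : ℝ) + 1)))) ∧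
      ∀ ν : Measure ℝ, IsProbabilityMeasure ν →
        (∀ s : ℕ, Integrable (fun x : ℝ => x ^ s) ν ∧ ∫ x, x ^ s ∂ν = ∫ x, x ^ s ∂μ) →
        ν = μ := by
  constructor
  · intro n m
    have hk0 : (0 : ℝ) < k := by exact_mod_cast hk
    have h1 : (m : ℝ) - ((k : ℝ) - 1) / k = 1 / (k : ℝ) + m - 1 := by
      field_simp
      ring
    have h2 : (n : ℝ) - (k : ℝ) / (k + 1) = 1 / ((k : ℝ) + 1) + n - 1 := by
      field_simp
      ring
    have h3 : ∀ l : ℕ, (n : ℝ) - 1 - (k : ℝ) * l / (k + 1) =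
        -((k : ℝ) / (k + 1) * l) + n - 1 := by
      intro l
      ring
    simp only [h1, h2, h3, ← Ring.multichoose_eq]
    rw [KTree.measureReal_rootOutDegree_eq, KTree.meanRootOutDegree_single]
    rfl
  · have hmeas : ∀ n : ℕ, AEMeasurable (fun T : KTree.OrderedIncreasingKTree k n =>
        (n : ℝ) ^ (-((k : ℝ) / (k + 1))) * (KTree.rootOutDegree hk n T : ℝ))
        (KTree.randomKTree k n) := fun n => Measurable.of_discrete.aemeasurable
    let μs : ℕ → ProbabilityMeasure ℝ := fun n =>
      ⟨(KTree.randomKTree k n).map fun T =>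
        (n : ℝ) ^ (-((k : ℝ) / (k + 1))) * (KTree.rootOutDegree hk n T : ℝ),
        Measure.isProbabilityMeasure_map (hmeas n)⟩
    have hint : ∀ n, ∀ s : ℕ, Integrable (fun x : ℝ => x ^ s) (μs n : Measure ℝ) := by
      intro n s
      refine (integrable_map_measure (by fun_prop) (hmeas n)).2 Integrable.of_finite
    have hlim : ∀ s : ℕ, Tendsto (fun n => ∫ x, x ^ s ∂(μs n : Measure ℝ)) atTop
        (nhds (KTree.limitMoment k s)) := by
      intro s
      refine (KTree.tendsto_mean_pow hk s).congr fun n => ?_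
      have : ∫ x, x ^ s ∂(μs n : Measure ℝ) = ∫ T, ((n : ℝ) ^ (-((k : ℝ) / (k + 1))) *
          (KTree.rootOutDegree hk n T : ℝ)) ^ s ∂(KTree.randomKTree k n) :=
        integral_map (hmeas n) (by fun_prop)
      rw [this]
      simp only [mul_pow]
      rw [integral_const_mul, ← Real.rpow_mul_natCast n.cast_nonneg, neg_mul]
      rfl
    obtain ⟨μ, hμ, hmom⟩ := exists_tendsto_of_moments hint hlim (KTree.limitMoment_growth hk)
    refine ⟨μ, inferInstance, ⟨hmeas, by fun_prop, ?_⟩, hmom, ?_⟩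
    · have : (⟨(μ : Measure ℝ).map (fun x => x),
          Measure.isProbabilityMeasure_map (by fun_prop)⟩ : ProbabilityMeasure ℝ) = μ :=
        Subtype.ext Measure.map_id'
      rw [this]
      exact hμ
    · intro ν hν hνm
      refine (ext_of_moments (fun s => (hmom s).1) (fun s => (hνm s).1)
        (fun s => (hνm s).2.symm) fun t => ?_).symm
      simpa only [(hmom _).2] using KTree.limitMoment_growth hk t
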